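/- Let $X(t,x)$ be a smooth $t$-dependent vector field on $\mathbb{R}^n$ (smooth means $C^\infty$ in $(t,x)$), write $X_t=X(t,\cdot)$, and consider the system $dx/dt=X(t,x)$. *Superposition rules.* A superposition rule depending on $m$ particular solutions that start in a set $U\subset\mathbb{R}^{nm}=(\mathbb{R}^n)^m$ is a smooth, $t$-independent map $\Phi:D\to\mathbb{R}^n$, $(x_{(1)},\dots,x_{(m)};k)\mapsto\Phi(x_{(1)},\dots,x_{(m)};k)$, on an open set $D\subset\mathbb{R}^{nm}\times\mathbb{R}^n$ such that: - for all particular solutions $x_{(1)}(t),\dots,x_{(m)}(t)$ on an open interval and every constant $k\in\mathbb{R}^n$ for which $(x_{(1)}(t),\dots,x_{(m)}(t);k)$ stays in $D$, the curve $t\mapsto\Phi(x_{(1)}(t),\dots,x_{(m)}(t);k)$ is a solution; - for all solutions $x_{(1)},\dots,x_{(m)},x$ on an open interval containing $t_0$ with $(x_{(1)}(t_0),\dots,x_{(m)}(t_0))\in U$ there is $k\in\mathbb{R}^n$ such that, for all $t$ near $t_0$, $(x_{(1)}(t),\dots,x_{(m)}(t);k)\in D$ and $x(t)=\Phi(x_{(1)}(t),\dots,x_{(m)}(t);k)$.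 The system admits a superposition rule depending on $m$ generic particular solutions if such a $\Phi$ exists with $U$ open and dense in $\mathbb{R}^{nm}$. *Decompositions.* By a decomposition of $X$ we mean $X_t=\sum_{\alpha=1}^r b_\alpha(t)X_\alpha$ with smooth functions $b_\alpha$ of $t$ and smooth vector fields $X_1,\dots,X_r$ on $\mathbb{R}^n$ that are linearly independent over $\mathbb{R}$ and whose real span is closed under the Lie bracket (so $X_1,\dots,X_r$ form a basis of an $r$-dimensional real Lie algebra). The diagonal prolongation of a vector field $Y$ to $\mathbb{R}^{nm}$ is $(x_{(1)},\dots,x_{(m)})\mapsto(Y(x_{(1)}),\dots,Y(x_{(m)}))$. Vector fields $Z_1,\dots,Z_r$ are linearly independent at a generic point if, over every open set $O$, $\sum_\alpha f_\alpha Z_\alpha=0$ with $f_\alpha\in C^\infty(O)$ implies $f_1=\dots=f_r=0$. **Theorem (Geometric Lie Theorem).** 1. The system admits, for some $m$, a superposition rule depending on $m$ generic particular solutions if and only if $X$ has a decomposition such that $X_1,\dots,X_r$ are linearly independent over $\mathbb{R}$ on every nonempty open subset of $\mathbb{R}^n$. 2. For each $m$, it admits a superposition rule depending on $m$ generic particular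 solutions if and only if $X$ has a decomposition such that the diagonal prolongations of $X_1,\dots,X_r$ to $\mathbb{R}^{nm}$ are linearly independent at a generic point, and $r\le mn$. 3. For every decomposition as in 1 there is a minimal number $m$ such that the diagonal prolongations of $X_1,\dots,X_r$ to $\mathbb{R}^{nm}$ are linearly independent at a generic point; it satisfies $m\le r\le mn$, and the system admits a superposition rule depending on $m$ generic particular solutions. 4. If the system admits a superposition rule depending on $m$ generic particular solutions, it admits one (with the same $m$) for which $\partial\Phi/\partial k$ is invertible at every point of $D$. 5. If every $X_t$ is real analytic, then the system admits, for some $m$, a superposition rule depending on $m$ generic particular solutions if and only if $X$ has a decomposition. 6. In general, $X$ has a decomposition if and only if, for some $m$ and some nonempty open $U\subset\mathbb{R}^{nm}$, there is a superposition rule depending on $m$ particular solutions that start in $U$. -/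

import Mathlib

open scoped ContDiff Topology

/-- The configuration space `ℝⁿ`. Vector fields on it are maps `E n → E n`, and the point
`(x₍₁₎, …, x₍ₘ₎)` of `ℝⁿᵐ = ℝⁿ × ⋯ × ℝⁿ` is a function `Fin m → E n`. -/
abbrev E (n : ℕ) : Type := EuclideanSpace ℝ (Fin n)

/-- `x` is a particular solution of the system `dx/dt = X(t, x)` on the set `I` of times
(used for open intervals `I`). -/
def IsSolutionOn {n : ℕ} (X : ℝ → E n → E n) (I : Set ℝ) (x : ℝ → E n) : Prop :=
  ∀ t ∈ I, HasDerivAt x (X t (x t)) t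

/-- The smooth `t`-independent map `Φ(x₍₁₎, …, x₍ₘ₎; k)`, defined on the open set `D` of
`ℝⁿᵐ × ℝⁿ`, expresses the general solution of `dx/dt = X(t, x)` through the constants
`k = (k₁, …, kₙ)` and any `m` particular solutions that start in `U`. -/
structure IsSuperpositionRule {n m : ℕ} (X : ℝ → E n → E n) (U : Set (Fin m → E n))
    (D : Set ((Fin m → E n) × E n)) (Φ : (Fin m → E n) × E n → E n) : Prop where
  isOpen_domain : IsOpen D
  contDiffOn : ContDiffOn ℝ ∞ Φ D
  /-- For every constant `k`, inserting particular solutions into `Φ` gives a solution. -/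
  isSolution : ∀ (a b : ℝ) (x : Fin m → ℝ → E n) (k : E n),
    (∀ i, IsSolutionOn X (Set.Ioo a b) (x i)) →
    (∀ t ∈ Set.Ioo a b, ((fun i => x i t), k) ∈ D) →
    IsSolutionOn X (Set.Ioo a b) (fun t => Φ ((fun i => x i t), k))
  /-- Every solution `y` is obtained in this way, around every time `t₀`, from every `m`-tuple of
  particular solutions whose value at `t₀` lies in `U`. -/
  recovers : ∀ (a b t₀ : ℝ), t₀ ∈ Set.Ioo a b → ∀ (x : Fin m → ℝ → E n) (y : ℝ → E n),
    (∀ i, IsSolutionOn X (Set.Ioo a b) (x i)) → IsSolutionOn X (Set.Ioo a b) y →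
    (fun i => x i t₀) ∈ U →
    ∃ k : E n, ∀ᶠ t in 𝓝 t₀, ((fun i => x i t), k) ∈ D ∧ y t = Φ ((fun i => x i t), k)

/-- The system admits a superposition rule depending on `m` generic particular solutions:
generic means that the initial values of the `m` solutions lie in an open dense set `U`. -/
def AdmitsSuperpositionRule {n : ℕ} (X : ℝ → E n → E n) (m : ℕ) : Prop :=
  ∃ (U : Set (Fin m → E n)) (D : Set ((Fin m → E n) × E n)) (Φ : (Fin m → E n) × E n → E n),
    IsOpen U ∧ Dense U ∧ IsSuperpositionRule X U D Φ

/-- The smooth vector fields `Y₁, …, Y_r` form a basis of an `r`-dimensional real Lie algebra of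
vector fields on `ℝⁿ`. -/
structure IsLieAlgebraBasis {n r : ℕ} (Y : Fin r → E n → E n) : Prop where
  contDiff : ∀ α, ContDiff ℝ ∞ (Y α)
  linearIndependent : LinearIndependent ℝ Y
  lieBracket_mem : ∀ α β,
    VectorField.lieBracket ℝ (Y α) (Y β) ∈ Submodule.span ℝ (Set.range Y)

/-- `X_t = ∑ α, b_α(t) Y_α` with smooth coefficients `b_α`. -/
def IsDecomposition {n r : ℕ} (X : ℝ → E n → E n) (Y : Fin r → E n → E n)
    (b : Fin r → ℝ → ℝ) : Prop :=
  (∀ α, ContDiff ℝ ∞ (b α)) ∧ ∀ t x, X t x = ∑ α, b α t • Y α x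

/-- The diagonal prolongation to `ℝⁿᵐ` of a vector field on `ℝⁿ`. -/
def diagonalProlongation {n : ℕ} (m : ℕ) (Y : E n → E n) : (Fin m → E n) → (Fin m → E n) :=
  fun p a => Y (p a)

/-- Linear independence at a generic point: over no open set is there a nontrivial linear relation
with smooth functions as coefficients. -/
def LinearIndependentAtGenericPoint {F : Type*} [NormedAddCommGroup F] [NormedSpace ℝ F] {r : ℕ}
    (Z : Fin r → F → F) : Prop :=
  ∀ (O : Set F), IsOpen O → ∀ f : Fin r → F → ℝ, (∀ α, ContDiffOn ℝ ∞ (f α) O) →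
    (∀ p ∈ O, ∑ α, f α p • Z α p = 0) → ∀ α, ∀ p ∈ O, f α p = 0

/-- The vector fields stay linearly independent over `ℝ` when restricted to any nonempty open set,
i.e. no nontrivial combination with constant coefficients vanishes on a nonempty open set. -/
def LinearIndependentOnOpens {n r : ℕ} (Y : Fin r → E n → E n) : Prop :=
  ∀ O : Set (E n), IsOpen O → O.Nonempty → LinearIndependent ℝ (fun α (x : O) => Y α x)

/-! From a rule to a decomposition. Differentiating `Φ(x₍₁₎(t), …, x₍ₘ₎(t); k)` shows that every
`Φ(·, k)` relates the prolongation of `X_t` to `X_t`. The smooth fields `Z` related in this way to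
their own prolongation (`relatedFields`) form a Lie algebra containing all `X_t`. Since `Φ(p, ·)`
reaches all of `ℝⁿ` when `p ∈ U`, the value of the prolongation of `Z` at one such `p` determines
`Z`. Hence this algebra embeds into `ℝⁿᵐ`: it is finite-dimensional, and a basis has prolongations
independent at every point of `U`.

From a decomposition to a rule. The fields `Z` (prolongations on `ℝⁿᵐ`) and `Y` (on `ℝⁿ`) satisfy
the same bracket relations. By `exists_smooth_flow`, the `u`-derivative of the time-one flow of `Z
u` is `Z` applied to `M(u) v`, where `M(u) = ∫₀¹ exp(-s B(u)) ds` depends only on the bracket. Where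
`Z` is injective, inverting its flow along a transversal gives a local group parameter `τ`; with `G`
the flow of `Y`, the map `Φ(p, k) = G(τ(p), k)` relates `Z` to `Y`, because the same `M` occurs on
both sides. No Lie group is integrated. The constants `k` are only labels, so countably many local
rules are glued by moving their parameter balls apart.

Genericity. Independence at a generic point amounts to pointwise independence on a dense set, by
maximal independent subfamilies with smooth coefficients. Independence over `ℝ` on open sets gives
pointwise independence of the `r`-th prolongations on a dense set, since each further point can
remove a remaining constant-coefficient relation. -/

/-! ### Composition operators on spaces of curves -/

section Nemytskii

universe u

/-- Pointwise application of a continuous family of linear maps to a continuous family of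
vectors, as a continuous bilinear map. -/
noncomputable def ContinuousMap.clmApplyL (K : Type*) [TopologicalSpace K] [CompactSpace K]
    (F G : Type*) [NormedAddCommGroup F] [NormedSpace ℝ F] [NormedAddCommGroup G]
    [NormedSpace ℝ G] : C(K, F →L[ℝ] G) →L[ℝ] C(K, F) →L[ℝ] C(K, G) :=
  LinearMap.mkContinuous₂
    (LinearMap.mk₂ ℝ
      (fun (A : C(K, F →L[ℝ] G)) (h : C(K, F)) =>
        (⟨fun s => A s (h s), A.continuous.clm_apply h.continuous⟩ : C(K, G)))
      (fun A A' h => by ext s; simp) (fun c A h => by ext s; simp)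
      (fun A h h' => by ext s; simp) (fun c A h => by ext s; simp)) 1
    (fun A h => by
      refine (ContinuousMap.norm_le _ (by positivity)).2 fun s => ?_
      calc ‖A s (h s)‖ ≤ ‖A s‖ * ‖h s‖ := (A s).le_opNorm _
        _ ≤ 1 * ‖A‖ * ‖h‖ := by
          rw [one_mul]
          exact mul_le_mul (A.norm_coe_le_norm s) (h.norm_coe_le_norm s) (norm_nonneg _)
            (norm_nonneg A))

@[simp]
theorem ContinuousMap.clmApplyL_apply {K : Type*} [TopologicalSpace K] [CompactSpace K]
    {F G : Type*} [NormedAddCommGroup F] [NormedSpace ℝ F] [NormedAddCommGroup G]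
    [NormedSpace ℝ G] (A : C(K, F →L[ℝ] G)) (h : C(K, F)) (s : K) :
    ContinuousMap.clmApplyL K F G A h s = A s (h s) := rfl

variable {K : Type*} [TopologicalSpace K] [CompactSpace K]

/-- The Nemytskii operator `γ ↦ f ∘ γ` of a `C¹` map is differentiable. -/
theorem ContinuousMap.hasFDerivAt_comp {F G : Type*} [NormedAddCommGroup F] [NormedSpace ℝ F]
    [NormedAddCommGroup G] [NormedSpace ℝ G] (f : C(F, G)) (f' : C(F, F →L[ℝ] G))
    (hf : ∀ x, HasFDerivAt f (f' x) x) (γ : C(K, F)) :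
    HasFDerivAt (fun γ : C(K, F) => f.comp γ)
      (ContinuousMap.clmApplyL K F G (f'.comp γ)) γ := by
  rw [hasFDerivAt_iff_isLittleO_nhds_zero, Asymptotics.isLittleO_iff]
  intro c hc
  have hcont : ContinuousAt (fun γ : C(K, F) => f'.comp γ) γ :=
    (ContinuousMap.continuous_postcomp f').continuousAt
  obtain ⟨δ, hδ, hball⟩ := (Metric.continuousAt_iff (f := fun γ : C(K, F) => f'.comp γ)).1 hcont c hc
  filter_upwards [Metric.ball_mem_nhds (0 : C(K, F)) hδ] with h hh
  rw [mem_ball_zero_iff] at hh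
  refine (ContinuousMap.norm_le _ (by positivity)).2 fun s => ?_
  -- Perturbing `γ` by the constant curve `v` turns continuity of `γ ↦ f' ∘ γ` into an estimate
  -- uniform in `s`, even though `F` need not be locally compact.
  have hsmall : ∀ v : F, ‖v‖ < δ → ‖f' (γ s + v) - f' (γ s)‖ ≤ c := by
    intro v hv
    have h1 : dist (γ + ContinuousMap.const K v) γ < δ := by
      rw [dist_eq_norm, add_sub_cancel_left]
      refine lt_of_le_of_lt ((ContinuousMap.norm_le _ (norm_nonneg v)).2 fun s => le_rfl) hv
    have h2 := hball h1
    rw [← dist_eq_norm]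
    exact (ContinuousMap.dist_apply_le_dist (f := f'.comp (γ + ContinuousMap.const K v))
      (g := f'.comp γ) s).trans h2.le
  have hmv := (convex_ball (γ s) δ).norm_image_sub_le_of_norm_hasFDerivWithin_le'
    (f := f) (f' := f') (φ := f' (γ s)) (C := c) (x := γ s) (y := γ s + h s)
    (fun x _ => (hf x).hasFDerivWithinAt)
    (fun x hx => by
      have := hsmall (x - γ s) (by simpa [dist_eq_norm] using hx)
      simpa using this)
    (Metric.mem_ball_self hδ)
    (by
      rw [mem_ball_iff_norm, add_sub_cancel_left]
      exact (h.norm_coe_le_norm s).trans_lt hh)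
  rw [add_sub_cancel_left] at hmv
  exact hmv.trans (mul_le_mul_of_nonneg_left (h.norm_coe_le_norm s) hc.le)

/-- The Nemytskii operator of a smooth map is smooth. -/
theorem ContinuousMap.contDiff_comp {F : Type u} [NormedAddCommGroup F] [NormedSpace ℝ F]
    {G : Type u} [NormedAddCommGroup G] [NormedSpace ℝ G] (f : C(F, G)) (hf : ContDiff ℝ ∞ f) :
    ContDiff ℝ ∞ (fun γ : C(K, F) => f.comp γ) := by
  rw [contDiff_infty]
  intro n
  -- The derivative is again a composition operator, now with target `F →L[ℝ] G`; so `G` must vary,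
  -- and `F`, `G` share a universe.
  induction n generalizing G with
  | zero =>
    exact contDiff_zero.2 (ContinuousMap.continuous_postcomp f)
  | succ n ih =>
    have hf' : ContDiff ℝ ∞ (fderiv ℝ f) := hf.fderiv_right (by simp)
    let f' : C(F, F →L[ℝ] G) := ⟨fderiv ℝ f, hf'.continuous⟩
    have hder : ∀ γ : C(K, F), HasFDerivAt (fun γ : C(K, F) => f.comp γ)
        (ContinuousMap.clmApplyL K F G (f'.comp γ)) γ :=
      ContinuousMap.hasFDerivAt_comp f f'
        fun x => (hf.differentiable (by simp) x).hasFDerivAt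
    push_cast
    rw [contDiff_succ_iff_hasFDerivAt]
    have hL : ContDiff ℝ n (ContinuousMap.clmApplyL K F G) :=
      ContinuousLinearMap.contDiff _
    exact ⟨fun γ => ContinuousMap.clmApplyL K F G (f'.comp γ), hL.comp (ih f' hf'), hder⟩

end Nemytskii

/-! ### Integration of curves on the unit interval -/

section IntegralOperator

variable {F : Type*} [NormedAddCommGroup F] [NormedSpace ℝ F]

/-- Extension of a curve on `[0, 1]` to `ℝ` by constants. -/
theorem continuous_comp_projIcc {F : Type*} [TopologicalSpace F] (γ : C(unitInterval, F)) :
    Continuous fun s : ℝ => γ (Set.projIcc 0 1 zero_le_one s) :=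
  γ.continuous.comp continuous_projIcc

/-- The integration operator `γ ↦ (t ↦ ∫₀ᵗ γ)` on curves on `[0, 1]`. -/
noncomputable def primitiveL (F : Type*) [NormedAddCommGroup F] [NormedSpace ℝ F] :
    C(unitInterval, F) →L[ℝ] C(unitInterval, F) :=
  LinearMap.mkContinuous
    { toFun := fun γ => ⟨fun t => ∫ s in (0 : ℝ)..t, γ (Set.projIcc 0 1 zero_le_one s),
        (intervalIntegral.continuous_primitive
          (fun _ _ => (continuous_comp_projIcc γ).intervalIntegrable _ _) 0).comp
          continuous_subtype_val⟩
      map_add' := fun γ γ' => by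
        ext t
        exact intervalIntegral.integral_add ((continuous_comp_projIcc γ).intervalIntegrable _ _)
          ((continuous_comp_projIcc γ').intervalIntegrable _ _)
      map_smul' := fun c γ => by
        ext t
        exact intervalIntegral.integral_smul c _ } 1
    (fun γ => by
      refine (ContinuousMap.norm_le _ (by positivity)).2 fun t => ?_
      refine (intervalIntegral.norm_integral_le_of_norm_le_const
        (fun s _ => γ.norm_coe_le_norm _)).trans ?_
      rw [sub_zero, abs_of_nonneg t.2.1, one_mul]
      exact mul_le_of_le_one_right (norm_nonneg _) t.2.2)

theorem primitiveL_apply (γ : C(unitInterval, F)) (t : unitInterval) :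
    primitiveL F γ t = ∫ s in (0 : ℝ)..t, γ (Set.projIcc 0 1 zero_le_one s) := rfl

theorem hasDerivAt_integral_projIcc [CompleteSpace F] (γ : C(unitInterval, F)) (t : ℝ) :
    HasDerivAt (fun t : ℝ => ∫ s in (0 : ℝ)..t, γ (Set.projIcc 0 1 zero_le_one s))
      (γ (Set.projIcc 0 1 zero_le_one t)) t :=
  intervalIntegral.integral_hasDerivAt_right ((continuous_comp_projIcc γ).intervalIntegrable _ _)
    (continuous_comp_projIcc γ).stronglyMeasurable.stronglyMeasurableAtFilter
    (continuous_comp_projIcc γ).continuousAt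

/-- A curve on `ℝ` that vanishes at `0` is the integral of its derivative on `[0, 1]`. -/
theorem eq_primitiveL_of_hasDerivAt [CompleteSpace F] (w : ℝ → F) (g : C(unitInterval, F))
    (h0 : w 0 = 0) (hw : ∀ t : unitInterval, HasDerivAt w (g t) t) (t : unitInterval) :
    w t = primitiveL F g t := by
  rw [primitiveL_apply, intervalIntegral.integral_eq_sub_of_hasDerivAt (f := w), h0, sub_zero]
  · intro s hs
    rw [Set.uIcc_of_le t.2.1] at hs
    have hs' : s ∈ Set.Icc (0 : ℝ) 1 := ⟨hs.1, hs.2.trans t.2.2⟩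
    rw [Set.projIcc_of_mem zero_le_one hs']
    exact hw ⟨s, hs'⟩
  · exact (continuous_comp_projIcc g).intervalIntegrable _ _

end IntegralOperator

/-! ### Smooth local inverses -/

section InverseFunction

/-- The inverse function theorem for smooth maps, with a smooth inverse on an open set. -/
theorem exists_openPartialHomeomorph_of_contDiffOn {A B : Type*} [NormedAddCommGroup A]
    [NormedSpace ℝ A] [CompleteSpace A] [NormedAddCommGroup B] [NormedSpace ℝ B]
    {f : A → B} {s : Set A} (hs : IsOpen s) (hf : ContDiffOn ℝ ∞ f s) {a : A} (ha : a ∈ s)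
    (e : A ≃L[ℝ] B) (he : fderiv ℝ f a = e) :
    ∃ φ : OpenPartialHomeomorph A B, (φ : A → B) = f ∧ a ∈ φ.source ∧ φ.source ⊆ s ∧
      ContDiffOn ℝ ∞ φ.symm φ.target ∧
      ∀ x ∈ φ.source, ∃ e' : A ≃L[ℝ] B, fderiv ℝ f x = e' := by
  have hfa : ContDiffAt ℝ ∞ f a := hf.contDiffAt (hs.mem_nhds ha)
  have hda : HasFDerivAt f (e : A →L[ℝ] B) a :=
    he ▸ (hfa.differentiableAt (by simp)).hasFDerivAt
  let φ₀ := hfa.toOpenPartialHomeomorph f hda (by simp)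
  have hcont : ContinuousOn (fderiv ℝ f) s := hf.continuousOn_fderiv_of_isOpen hs (by simp)
  -- Restricting to the open set where the derivative is invertible makes the inverse smooth on the
  -- whole target, not only near the image of `a`.
  let s' : Set A := s ∩ fderiv ℝ f ⁻¹' Set.range ((↑) : (A ≃L[ℝ] B) → A →L[ℝ] B)
  have hs' : IsOpen s' := hcont.isOpen_inter_preimage hs (ContinuousLinearEquiv.isOpen)
  refine ⟨φ₀.restrOpen s' hs', rfl, ⟨hfa.mem_toOpenPartialHomeomorph_source hda (by simp),
    ha, e, he.symm⟩, fun x hx => hx.2.1, ?_, ?_⟩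
  · intro y hy
    have hx := (φ₀.restrOpen s' hs').map_target hy
    obtain ⟨-, hxs, e', he'⟩ := hx
    have hx1 : ContDiffAt ℝ ∞ f ((φ₀.restrOpen s' hs').symm y) :=
      hf.contDiffAt (hs.mem_nhds hxs)
    refine (OpenPartialHomeomorph.contDiffAt_symm (φ₀.restrOpen s' hs') (f₀' := e') hy ?_
      hx1).contDiffWithinAt
    rw [he']
    exact (hx1.differentiableAt (by simp)).hasFDerivAt
  · rintro x ⟨-, -, e', he'⟩
    exact ⟨e', he'.symm⟩

end InverseFunction

/-! ### The operator `∫₀ᵗ exp(-sA) ds` -/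

section AdjointIntegral

variable {W : Type*} [NormedAddCommGroup W] [NormedSpace ℝ W]

/-- The primitive `∫₀ᵗ exp(-sA) ds`. -/
noncomputable def expPrimitive (A : W →L[ℝ] W) (t : ℝ) : W →L[ℝ] W :=
  ∫ s in (0 : ℝ)..t, NormedSpace.exp (s • (-A))

theorem continuous_exp_smul [CompleteSpace W] (A : W →L[ℝ] W) :
    Continuous fun s : ℝ => NormedSpace.exp (s • (-A)) :=
  continuous_iff_continuousAt.2 fun t => (hasDerivAt_exp_smul_const (-A) t).continuousAt

@[simp]
theorem expPrimitive_zero (A : W →L[ℝ] W) : expPrimitive A 0 = 0 := by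
  simp [expPrimitive]

variable [CompleteSpace W]

theorem hasDerivAt_expPrimitive_exp (A : W →L[ℝ] W) (t : ℝ) :
    HasDerivAt (expPrimitive A) (NormedSpace.exp (t • (-A))) t :=
  intervalIntegral.integral_hasDerivAt_right ((continuous_exp_smul A).intervalIntegrable _ _)
    (continuous_exp_smul A).stronglyMeasurable.stronglyMeasurableAtFilter
    (continuous_exp_smul A).continuousAt

/-- `expPrimitive A` solves the linear equation `M' = 1 - A M`. -/
theorem hasDerivAt_expPrimitive (A : W →L[ℝ] W) (t : ℝ) :
    HasDerivAt (expPrimitive A) (1 - A * expPrimitive A t) t := by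
  -- The quantity `exp(-tA) + A M(t)` is conserved and equals `1` at `t = 0`; this converts `M' =
  -- exp(-tA)` into the linear equation.
  have key : ∀ t : ℝ, HasDerivAt
      (fun t => NormedSpace.exp (t • (-A)) + A * expPrimitive A t) 0 t := by
    intro t
    have h := (hasDerivAt_exp_smul_const' (-A) t).add
      ((hasDerivAt_expPrimitive_exp A t).const_mul A)
    refine h.congr_deriv ?_
    rw [neg_mul, neg_add_cancel]
  have hconst := is_const_of_deriv_eq_zero (fun t => (key t).differentiableAt)
    (fun t => (key t).deriv) t 0
  simp only [zero_smul, NormedSpace.exp_zero, expPrimitive_zero, mul_zero, add_zero] at hconst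
  rw [← hconst, add_sub_cancel_right]
  exact hasDerivAt_expPrimitive_exp A t

/-- The operator is the identity at `u = 0`, depends continuously on `u`, and units form an open
set. -/
theorem eventually_surjective_expPrimitive (B : W →L[ℝ] W →L[ℝ] W) :
    ∀ᶠ u in 𝓝 (0 : W), Function.Surjective (expPrimitive (B u) 1) := by
  have hcont : Continuous fun u : W => expPrimitive (B u) 1 := by
    refine intervalIntegral.continuous_parametric_intervalIntegral_of_continuous' ?_ 0 1
    let _ : NormedAlgebra ℚ (W →L[ℝ] W) := NormedAlgebra.restrictScalars ℚ ℝ _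
    exact NormedSpace.exp_continuous.comp (by fun_prop)
  have h0 : IsUnit (expPrimitive (B 0) 1) := by
    have : expPrimitive (B 0) 1 = 1 := by simp [expPrimitive]
    rw [this]
    exact isUnit_one
  filter_upwards [hcont.continuousAt.preimage_mem_nhds (Units.isOpen.mem_nhds h0)] with u hu
  obtain ⟨a, ha⟩ := hu
  have ha : (a : W →L[ℝ] W) = expPrimitive (B u) 1 := ha
  intro v
  refine ⟨(a⁻¹ : (W →L[ℝ] W)ˣ).val v, ?_⟩
  have : (a * a⁻¹).val v = v := by simp
  rw [← ha]
  exact this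

end AdjointIntegral

/-! ### Time-one flows and their parameter derivatives -/

section Flow

universe u

variable {F W : Type u} [NormedAddCommGroup F] [NormedSpace ℝ F]
  [NormedAddCommGroup W] [NormedSpace ℝ W]

/-- Pointwise application of a curve of linear maps to a fixed vector, as a continuous bilinear
map. -/
noncomputable def applyVectorL (W F : Type u) [NormedAddCommGroup F] [NormedSpace ℝ F]
    [NormedAddCommGroup W] [NormedSpace ℝ W] :
    C(unitInterval, W →L[ℝ] F) →L[ℝ] W →L[ℝ] C(unitInterval, F) :=
  ((ContinuousLinearMap.precomp C(unitInterval, F)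
    (ContinuousLinearMap.const ℝ unitInterval : W →L[ℝ] C(unitInterval, W)))).comp
    (ContinuousMap.clmApplyL unitInterval W F)

@[simp]
theorem applyVectorL_apply (A : C(unitInterval, W →L[ℝ] F)) (v : W) (t : unitInterval) :
    applyVectorL W F A v t = A t v := rfl

/-- The curve `γ` solves `γ' = Z(γ) u` on `[0, 1]` with `γ(0) = q` iff this map vanishes at
`((u, q), γ)`. -/
noncomputable def flowResidual (Z : C(F, W →L[ℝ] F)) (z : (W × F) × C(unitInterval, F)) :
    C(unitInterval, F) :=
  z.2 - ContinuousLinearMap.const ℝ unitInterval z.1.2 -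
    primitiveL F (applyVectorL W F (Z.comp z.2) z.1.1)

theorem contDiff_flowResidual (Z : C(F, W →L[ℝ] F)) (hZ : ContDiff ℝ ∞ Z) :
    ContDiff ℝ ∞ (flowResidual Z) := by
  have h1 : ContDiff ℝ ∞ fun z : (W × F) × C(unitInterval, F) => Z.comp z.2 :=
    (ContinuousMap.contDiff_comp Z hZ).comp contDiff_snd
  have h2 : ContDiff ℝ ∞ (applyVectorL W F) := ContinuousLinearMap.contDiff _
  have h3 : ContDiff ℝ ∞ (primitiveL F) := ContinuousLinearMap.contDiff _
  have h4 : ContDiff ℝ ∞ (ContinuousLinearMap.const ℝ unitInterval : F →L[ℝ] _) :=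
    ContinuousLinearMap.contDiff _
  exact (contDiff_snd.sub (h4.comp contDiff_fst.snd)).sub
    (h3.comp ((h2.comp h1).clm_apply contDiff_fst.fst))

/-- Linearising the integral equation gives the variational equation of the flow, also in integral
form. -/
theorem exists_hasFDerivAt_flowResidual (Z : C(F, W →L[ℝ] F)) (Z' : C(F, F →L[ℝ] W →L[ℝ] F))
    (hZ : ∀ q, HasFDerivAt Z (Z' q) q) (z : (W × F) × C(unitInterval, F)) :
    ∃ R' : (W × F) × C(unitInterval, F) →L[ℝ] C(unitInterval, F),
      HasFDerivAt (flowResidual Z) R' z ∧ ∀ d, R' d =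
        d.2 - ContinuousLinearMap.const ℝ unitInterval d.1.2 -
          primitiveL F (applyVectorL W F (Z.comp z.2) d.1.1 +
            applyVectorL W F
              (ContinuousMap.clmApplyL unitInterval F (W →L[ℝ] F) (Z'.comp z.2) d.2) z.1.1) := by
  have h1 : HasFDerivAt (fun z : (W × F) × C(unitInterval, F) => Z.comp z.2) _ z :=
    (ContinuousMap.hasFDerivAt_comp Z Z' hZ z.2).comp z hasFDerivAt_snd
  have h2 := (applyVectorL W F).hasFDerivAt_of_bilinear h1
    ((ContinuousLinearMap.fst ℝ W F).comp (ContinuousLinearMap.fst ℝ (W × F)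
      C(unitInterval, F))).hasFDerivAt
  have h3 := (primitiveL F).hasFDerivAt.comp z h2
  have h4 := ((ContinuousLinearMap.const ℝ unitInterval : F →L[ℝ] _).comp
    ((ContinuousLinearMap.snd ℝ W F).comp (ContinuousLinearMap.fst ℝ (W × F)
      C(unitInterval, F)))).hasFDerivAt (x := z)
  exact ⟨_, ((hasFDerivAt_snd (p := z)).sub h4).sub h3, fun d => rfl⟩

variable [CompleteSpace F] [CompleteSpace W]

/-- The derivative of the flow with respect to `u`, along an integral curve of `Z u`. -/
theorem eq_primitiveL_variation (Z : C(F, W →L[ℝ] F)) (Z' : C(F, F →L[ℝ] W →L[ℝ] F))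
    (hZ : ∀ q, HasFDerivAt Z (Z' q) q) (B : W →L[ℝ] W →L[ℝ] W)
    (hB : ∀ q u v, Z' q (Z q u) v - Z' q (Z q v) u = Z q (B u v))
    {z : (W × F) × C(unitInterval, F)} (hz : flowResidual Z z = 0) (v : W) :
    ∃ w : C(unitInterval, F), (∀ t, w t = Z (z.2 t) (expPrimitive (B z.1.1) t v)) ∧
      w = primitiveL F (applyVectorL W F (Z.comp z.2) v +
            applyVectorL W F
              (ContinuousMap.clmApplyL unitInterval F (W →L[ℝ] F) (Z'.comp z.2) w) z.1.1) := by
  obtain ⟨⟨u, q⟩, γ⟩ := z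
  dsimp only at *
  set f : C(unitInterval, F) := applyVectorL W F (Z.comp γ) u with hf
  have hM : ∀ t, HasDerivAt (fun t => expPrimitive (B u) t v)
      (v - B u (expPrimitive (B u) t v)) t := fun t =>
    ((hasDerivAt_expPrimitive (B u) t).clm_apply (hasDerivAt_const t v)).congr_deriv (by simp)
  have hMc : Continuous fun t => expPrimitive (B u) t v :=
    continuous_iff_continuousAt.2 fun t => (hM t).continuousAt
  -- This extension of `γ` to `ℝ` has two-sided derivatives also at the endpoints `0` and `1`.
  let γ' : ℝ → F := fun t => q + ∫ s in (0 : ℝ)..t, f (Set.projIcc 0 1 zero_le_one s)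
  have hγ' : ∀ t, HasDerivAt γ' (f (Set.projIcc 0 1 zero_le_one t)) t := fun t =>
    (hasDerivAt_integral_projIcc f t).const_add q
  have hγ : ∀ t : unitInterval, γ t = γ' t := by
    intro t
    have h := congrArg (fun g : C(unitInterval, F) => g t) hz
    simp only [flowResidual, ContinuousMap.sub_apply, ContinuousMap.zero_apply] at h
    rw [sub_sub, sub_eq_zero] at h
    exact h
  let w : C(unitInterval, F) := ⟨fun t => Z (γ t) (expPrimitive (B u) t v),
    (Z.continuous.comp γ.continuous).clm_apply (hMc.comp continuous_subtype_val)⟩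
  refine ⟨w, fun t => rfl, ?_⟩
  ext t
  have hder : ∀ t : unitInterval,
      HasDerivAt (fun t : ℝ => Z (γ' t) (expPrimitive (B u) t v))
      ((applyVectorL W F (Z.comp γ) v + applyVectorL W F
        (ContinuousMap.clmApplyL unitInterval F (W →L[ℝ] F) (Z'.comp γ) w) u) t) t := by
    -- With `w = Z(γ) M v`, the bracket identity and `M' = 1 - B(u) M` give exactly `w' = Z(γ) v +
    -- Z'(γ)(w) u`.
    intro t
    have h1 := ((hZ (γ' t)).comp_hasDerivAt (t : ℝ) (hγ' t)).clm_apply (hM t)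
    refine h1.congr_deriv ?_
    rw [Set.projIcc_val]
    have h2 := hB (γ t) u (expPrimitive (B u) t v)
    simp only [Function.comp, ContinuousMap.add_apply, applyVectorL_apply, ContinuousMap.comp_apply,
      ContinuousMap.clmApplyL_apply, ← hγ, map_sub, ← h2, hf]
    change _ = _ + Z' (γ t) (Z (γ t) (expPrimitive (B u) t v)) u
    abel
  rw [← eq_primitiveL_of_hasDerivAt _ _ (by simp) hder t, ← hγ]
  rfl

/-- **Smooth dependence of the time-one flow on parameters and initial values**, for a family of
vector fields `Z u` depending linearly on `u` and closed under the bracket. The derivative in `u`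
is again given by the vector fields, through a map depending on the bracket only. -/
theorem exists_smooth_flow (Z : F → W →L[ℝ] F) (hZ : ContDiff ℝ ∞ Z) (B : W →L[ℝ] W →L[ℝ] W)
    (hB : ∀ q u v, fderiv ℝ Z q (Z q u) v - fderiv ℝ Z q (Z q v) u = Z q (B u v)) (q₀ : F) :
    ∃ (s : Set (W × F)) (G : W × F → F), IsOpen s ∧ (0, q₀) ∈ s ∧ ContDiffOn ℝ ∞ G s ∧
      (∀ q, (0, q) ∈ s → G (0, q) = q) ∧
      ∀ z ∈ s, ∀ v, fderiv ℝ G z (v, 0) = Z (G z) (expPrimitive (B z.1) 1 v) := by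
  let Zc : C(F, W →L[ℝ] F) := ⟨Z, hZ.continuous⟩
  have hZ' : ContDiff ℝ ∞ (fderiv ℝ Z) := hZ.fderiv_right (by simp)
  let Z' : C(F, F →L[ℝ] W →L[ℝ] F) := ⟨fderiv ℝ Z, hZ'.continuous⟩
  have hder : ∀ q, HasFDerivAt Zc (Z' q) q := fun q =>
    (hZ.differentiable (by simp) q).hasFDerivAt
  -- Implicit function theorem in a space of curves: invert `(z, γ) ↦ (z, residual)` and set the
  -- residual to zero.
  let Θ : (W × F) × C(unitInterval, F) → (W × F) × C(unitInterval, F) :=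
    fun z => (z.1, flowResidual Zc z)
  have hΘ : ContDiff ℝ ∞ Θ := contDiff_fst.prodMk (contDiff_flowResidual Zc hZ)
  let z₀ : (W × F) × C(unitInterval, F) := ((0, q₀), ContinuousMap.const _ q₀)
  obtain ⟨R₀, hR₀, hR₀'⟩ := exists_hasFDerivAt_flowResidual Zc Z' hder z₀
  have hfst : ∀ z : (W × F) × C(unitInterval, F), HasFDerivAt
      (Prod.fst : (W × F) × C(unitInterval, F) → W × F) (ContinuousLinearMap.fst ℝ _ _) z :=
    fun z => hasFDerivAt_fst
  have hΘ₀ : HasFDerivAt Θ ((ContinuousLinearMap.fst ℝ _ _).prod R₀) z₀ := (hfst z₀).prodMk hR₀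
  -- At `u = 0` the variation of the curve drops out of the integral, so the partial derivative in
  -- `γ` is the identity and the inverse of `Θ'` is explicit.
  have hR₀'' : ∀ d, R₀ d = d.2 - ContinuousLinearMap.const ℝ unitInterval d.1.2 -
      primitiveL F (applyVectorL W F (Zc.comp z₀.2) d.1.1) := by
    intro d
    rw [hR₀']
    simp [z₀]
  let S : (W × F) × C(unitInterval, F) →L[ℝ] C(unitInterval, F) :=
    ContinuousLinearMap.snd ℝ _ _ - R₀
  have hS : ∀ d, S d = ContinuousLinearMap.const ℝ unitInterval d.1.2 +
      primitiveL F (applyVectorL W F (Zc.comp z₀.2) d.1.1) := by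
    intro d
    simp only [S, _root_.sub_apply, hR₀'', ContinuousLinearMap.coe_snd']
    abel
  let e : ((W × F) × C(unitInterval, F)) ≃L[ℝ] (W × F) × C(unitInterval, F) :=
    ContinuousLinearEquiv.equivOfInverse ((ContinuousLinearMap.fst ℝ _ _).prod R₀)
      ((ContinuousLinearMap.fst ℝ _ _).prod (ContinuousLinearMap.snd ℝ _ _ + S))
      (fun d => Prod.ext rfl (by
        simp only [ContinuousLinearMap.prod_apply, _root_.add_apply, hS, hR₀'',
          ContinuousLinearMap.coe_fst', ContinuousLinearMap.coe_snd']
        abel))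
      (fun d => Prod.ext rfl (by
        simp only [ContinuousLinearMap.prod_apply, _root_.add_apply, hS, hR₀'',
          ContinuousLinearMap.coe_fst', ContinuousLinearMap.coe_snd']
        abel))
  obtain ⟨φ, hφ, hz₀, -, hsymm, hinv⟩ := exists_openPartialHomeomorph_of_contDiffOn isOpen_univ
    hΘ.contDiffOn (Set.mem_univ z₀) e hΘ₀.fderiv
  let ι : W × F → (W × F) × C(unitInterval, F) := fun z => (z, 0)
  have hι : ContDiff ℝ ∞ ι := contDiff_id.prodMk contDiff_const
  let s : Set (W × F) := ι ⁻¹' φ.target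
  have hs : IsOpen s := φ.open_target.preimage hι.continuous
  let Γ : W × F → C(unitInterval, F) := fun z => (φ.symm (ι z)).2
  have hΓ : ContDiffOn ℝ ∞ Γ s := contDiff_snd.comp_contDiffOn
    (hsymm.comp hι.contDiffOn fun z hz => hz)
  have hval : ∀ z ∈ s, φ.symm (ι z) = (z, Γ z) ∧ flowResidual Zc (z, Γ z) = 0 := by
    intro z hz
    have h1 : Θ (φ.symm (ι z)) = ι z := by
      rw [← hφ]
      exact φ.right_inv hz
    have h2 : (φ.symm (ι z)).1 = z := congrArg Prod.fst h1
    have h3 : φ.symm (ι z) = (z, Γ z) := Prod.ext h2 rfl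
    exact ⟨h3, by rw [← h3]; exact congrArg Prod.snd h1⟩
  refine ⟨s, fun z => Γ z 1, hs, ?_, ?_, ?_, ?_⟩
  · have h1 : Θ z₀ = ι (0, q₀) := by
      refine Prod.ext rfl ?_
      simp only [Θ, ι, flowResidual, z₀, map_zero, sub_zero]
      exact sub_self _
    change ι (0, q₀) ∈ φ.target
    rw [← h1, ← hφ]
    exact φ.map_source hz₀
  · exact (ContinuousMap.evalCLM ℝ (1 : unitInterval)).contDiff.comp_contDiffOn hΓ
  · intro q hq
    have h := (hval _ hq).2
    simp only [flowResidual, map_zero, sub_zero, sub_eq_zero] at h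
    change Γ (0, q) 1 = q
    rw [h]
    rfl
  · intro z hz v
    obtain ⟨h3, h0⟩ := hval z hz
    have hΓz : HasFDerivAt Γ (fderiv ℝ Γ z) z :=
      ((hΓ.contDiffAt (hs.mem_nhds hz)).differentiableAt (by simp)).hasFDerivAt
    have hG : HasFDerivAt (fun z => Γ z 1)
        ((ContinuousMap.evalCLM ℝ (1 : unitInterval)).comp (fderiv ℝ Γ z)) z :=
      (ContinuousMap.evalCLM (M := F) ℝ (1 : unitInterval)).hasFDerivAt.comp z hΓz
    obtain ⟨R, hR, hR'⟩ := exists_hasFDerivAt_flowResidual Zc Z' hder (z, Γ z)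
    have hcomp : HasFDerivAt (fun z => flowResidual Zc (z, Γ z)) _ z :=
      HasFDerivAt.comp z (f := fun z => (z, Γ z)) hR ((hasFDerivAt_id z).prodMk hΓz)
    have hzero : HasFDerivAt (fun z => flowResidual Zc (z, Γ z))
        (0 : W × F →L[ℝ] C(unitInterval, F)) z :=
      (hasFDerivAt_const (0 : C(unitInterval, F)) z).congr_of_eventuallyEq (by
        filter_upwards [hs.mem_nhds hz] with z' hz'
        exact (hval z' hz').2)
    have hlin := congrArg (fun A : W × F →L[ℝ] C(unitInterval, F) => A (v, 0))
      (hcomp.unique hzero)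
    simp only [ContinuousLinearMap.comp_apply, ContinuousLinearMap.prod_apply,
      ContinuousLinearMap.id_apply, _root_.zero_apply, hR', map_zero,
      sub_zero] at hlin
    obtain ⟨w, hw, hw'⟩ := eq_primitiveL_variation Zc Z' hder B hB h0 v
    -- Both curves solve the same linearised equation; invertibility of the derivative of `Θ` forces
    -- them to coincide.
    have hd : R ((0, 0), fderiv ℝ Γ z (v, 0) - w) = 0 := by
      rw [hR']
      simp only [map_zero, sub_zero, zero_add, map_sub, map_add,
        _root_.sub_apply] at hlin hw' ⊢
      rw [sub_eq_zero] at hlin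
      nth_rewrite 1 [hlin]
      nth_rewrite 1 [hw']
      abel
    obtain ⟨e', he'⟩ := hinv _ (φ.map_target hz)
    rw [h3] at he'
    have hΘz : HasFDerivAt Θ ((ContinuousLinearMap.fst ℝ _ _).prod R) (z, Γ z) :=
      (hfst _).prodMk hR
    rw [hΘz.fderiv] at he'
    have hzero' : e' ((0, 0), fderiv ℝ Γ z (v, 0) - w) = 0 := by
      rw [← ContinuousLinearEquiv.coe_coe, ← he']
      exact Prod.ext rfl hd
    rw [map_eq_zero_iff _ e'.injective] at hzero'
    have hfin : fderiv ℝ Γ z (v, 0) = w := sub_eq_zero.1 (congrArg Prod.snd hzero')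
    rw [hG.fderiv, ContinuousLinearMap.comp_apply, hfin]
    exact hw 1

end Flow

/-! ### Local group parameters and local superposition rules -/

section LocalRule

universe u

variable {V W : Type u} [NormedAddCommGroup V] [NormedSpace ℝ V]
  [NormedAddCommGroup W] [NormedSpace ℝ W]

theorem fderiv_flow_snd {s : Set (W × V)} {G : W × V → V} (hs : IsOpen s)
    (hG : DifferentiableOn ℝ G s) (hid : ∀ q, (0, q) ∈ s → G (0, q) = q) {q₀ : V}
    (hq₀ : (0, q₀) ∈ s) (y : V) : fderiv ℝ G (0, q₀) (0, y) = y := by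
  have hι : HasFDerivAt (fun q : V => ((0 : W), q)) (ContinuousLinearMap.inr ℝ W V) q₀ :=
    (ContinuousLinearMap.inr ℝ W V).hasFDerivAt
  have h1 : HasFDerivAt (fun q : V => G (0, q)) _ q₀ :=
    HasFDerivAt.comp q₀ (hG.differentiableAt (hs.mem_nhds hq₀)).hasFDerivAt hι
  have h2 : HasFDerivAt (fun q : V => G (0, q)) (ContinuousLinearMap.id ℝ V) q₀ :=
    (hasFDerivAt_id q₀).congr_of_eventuallyEq (by
      filter_upwards [hι.continuousAt.preimage_mem_nhds (hs.mem_nhds hq₀)] with q hq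
      exact hid q hq)
  exact congrArg (fun A : V →L[ℝ] V => A y) (h1.unique h2)

variable [FiniteDimensional ℝ V] [FiniteDimensional ℝ W]

/-- Near a point where the vector fields `Z` are independent, the group parameter of the local
action is a smooth function, up to the choice of a transversal. -/
theorem exists_local_group_parameter (Z : V → W →L[ℝ] V) (hZ : ContDiff ℝ ∞ Z)
    (B : W →L[ℝ] W →L[ℝ] W)
    (hB : ∀ q u v, fderiv ℝ Z q (Z q u) v - fderiv ℝ Z q (Z q v) u = Z q (B u v)) (p₀ : V)
    (hinj : Function.Injective (Z p₀)) :
    ∃ (A : Set V) (τ : V → W), IsOpen A ∧ p₀ ∈ A ∧ ContDiffOn ℝ ∞ τ A ∧ τ p₀ = 0 ∧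
      ∀ p ∈ A, Function.Surjective (expPrimitive (B (τ p)) 1) ∧
        ∀ v, fderiv ℝ τ p (Z p (expPrimitive (B (τ p)) 1 v)) = v := by
  have : CompleteSpace V := FiniteDimensional.complete ℝ V
  have : CompleteSpace W := FiniteDimensional.complete ℝ W
  obtain ⟨s, G, hs, hs₀, hG, hid, hflow⟩ := exists_smooth_flow Z hZ B hB p₀
  obtain ⟨N, hN, hNo, hN₀⟩ := eventually_nhds_iff.1 (eventually_surjective_expPrimitive B)
  -- The affine space `p₀ + S` is a transversal to the orbit; flowing out from it gives the local
  -- coordinates `H`.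
  obtain ⟨S, hS⟩ := Submodule.exists_isCompl (LinearMap.range (Z p₀ : W →ₗ[ℝ] V))
  let ι : W × S → W × V := fun x => (x.1, p₀ + x.2)
  have hι : ContDiff ℝ ∞ ι :=
    contDiff_fst.prodMk (contDiff_const.add (S.subtypeL.contDiff.comp contDiff_snd))
  have hι' : ∀ x, HasFDerivAt ι
      ((ContinuousLinearMap.fst ℝ W S).prod (S.subtypeL.comp (ContinuousLinearMap.snd ℝ W S))) x :=
    fun x => hasFDerivAt_fst.prodMk
      ((S.subtypeL.comp (ContinuousLinearMap.snd ℝ W S)).hasFDerivAt.const_add p₀)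
  have hι₀ : ι 0 = (0, p₀) := by simp [ι]
  let s' : Set (W × S) := ι ⁻¹' s ∩ Prod.fst ⁻¹' N
  have hs' : IsOpen s' := (hs.preimage hι.continuous).inter (hNo.preimage continuous_fst)
  have h0s' : (0 : W × S) ∈ s' := ⟨by rw [Set.mem_preimage, hι₀]; exact hs₀, hN₀⟩
  let H : W × S → V := fun x => G (ι x)
  have hH : ContDiffOn ℝ ∞ H s' := hG.comp hι.contDiffOn fun x hx => hx.1
  have hGd : ∀ z ∈ s, HasFDerivAt G (fderiv ℝ G z) z := fun z hz =>
    ((hG.contDiffAt (hs.mem_nhds hz)).differentiableAt (by simp)).hasFDerivAt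
  have hHd : ∀ x ∈ s', HasFDerivAt H ((fderiv ℝ G (ι x)).comp
      ((ContinuousLinearMap.fst ℝ W S).prod (S.subtypeL.comp (ContinuousLinearMap.snd ℝ W S)))) x :=
    fun x hx => (hGd _ hx.1).comp x (hι' x)
  let e : (W × S) ≃L[ℝ] V :=
    (((LinearEquiv.ofInjective (Z p₀ : W →ₗ[ℝ] V) hinj).prodCongr (LinearEquiv.refl ℝ S)).trans
      (Submodule.prodEquivOfIsCompl _ _ hS)).toContinuousLinearEquiv
  have he : fderiv ℝ H 0 = e := by
    rw [(hHd 0 h0s').fderiv, hι₀]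
    refine ContinuousLinearMap.ext fun x => ?_
    change fderiv ℝ G (0, p₀) (x.1, x.2) = Z p₀ x.1 + x.2
    have h1 := hflow (0, p₀) hs₀ x.1
    have h2 := fderiv_flow_snd hs (hG.differentiableOn (by simp)) hid hs₀ (x.2 : V)
    have h3 : expPrimitive (B 0) 1 = 1 := by simp [expPrimitive]
    rw [hid p₀ hs₀, h3] at h1
    have h4 : ((x.1, (x.2 : V)) : W × V) = (x.1, 0) + (0, (x.2 : V)) := by simp
    rw [h4, map_add, h1, h2]
    rfl
  obtain ⟨φ, hφ, h0φ, hsub, hsymm, -⟩ := exists_openPartialHomeomorph_of_contDiffOn hs' hH h0s' e he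
  have hH0 : H 0 = p₀ := by
    change G (ι 0) = p₀
    rw [hι₀, hid p₀ hs₀]
  refine ⟨φ.target, fun p => (φ.symm p).1, φ.open_target, ?_, contDiff_fst.comp_contDiffOn hsymm,
    ?_, ?_⟩
  · rw [← hH0, ← hφ]
    exact φ.map_source h0φ
  · change (φ.symm p₀).1 = 0
    rw [← hH0, ← hφ, φ.left_inv h0φ]
    rfl
  · intro p hp
    have hx := φ.map_target hp
    refine ⟨hN _ (hsub hx).2, fun v => ?_⟩
    have hHx : H (φ.symm p) = p := by
      rw [← hφ]
      exact φ.right_inv hp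
    have hsd : HasFDerivAt φ.symm (fderiv ℝ φ.symm p) p :=
      ((hsymm.contDiffAt (φ.open_target.mem_nhds hp)).differentiableAt (by simp)).hasFDerivAt
    have hτ : HasFDerivAt (fun p => (φ.symm p).1)
        ((ContinuousLinearMap.fst ℝ W S).comp (fderiv ℝ φ.symm p)) p :=
      (ContinuousLinearMap.fst ℝ W S).hasFDerivAt.comp p hsd
    have h1 : HasFDerivAt (fun x => φ.symm (H x)) _ (φ.symm p) :=
      HasFDerivAt.comp (φ.symm p) (by rw [hHx]; exact hsd) (hHd _ (hsub hx))
    have h2 : HasFDerivAt (fun x => φ.symm (H x)) (ContinuousLinearMap.id ℝ (W × S)) (φ.symm p) :=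
      (hasFDerivAt_id _).congr_of_eventuallyEq (by
        filter_upwards [φ.open_source.mem_nhds hx] with x hx'
        rw [← hφ]
        exact φ.left_inv hx')
    -- Differentiating `φ.symm ∘ H = id` in the group direction `v` yields the stated derivative of
    -- `τ`.
    have h3 := congrArg (fun A : W × S →L[ℝ] W × S => A (v, 0)) (h1.unique h2)
    have h4 := hflow (ι (φ.symm p)) (hsub hx).1 v
    change _ = Z (H (φ.symm p)) _ at h4
    rw [hHx] at h4
    change fderiv ℝ φ.symm p (fderiv ℝ G (ι (φ.symm p)) (v, 0)) = (v, 0) at h3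
    rw [h4] at h3
    rw [hτ.fderiv]
    exact congrArg Prod.fst h3

variable {M : Type u} [NormedAddCommGroup M] [NormedSpace ℝ M] [FiniteDimensional ℝ M]

/-- A smooth family of maps `Φ(·, k)` that relates the vector fields `Z` to the vector fields `Y`
and is locally invertible in the parameter `k`. -/
structure IsRelatedFamily {V W M : Type*} [NormedAddCommGroup V] [NormedSpace ℝ V]
    [NormedAddCommGroup W] [NormedSpace ℝ W] [NormedAddCommGroup M] [NormedSpace ℝ M]
    (Z : V → W →L[ℝ] V) (Y : M → W →L[ℝ] M) (D : Set (V × M)) (Φ : V × M → M) : Prop where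
  isOpen : IsOpen D
  contDiffOn : ContDiffOn ℝ ∞ Φ D
  related : ∀ z ∈ D, ∀ a, fderiv ℝ Φ z (Z z.1 a, 0) = Y (Φ z) a
  bijective : ∀ z ∈ D, Function.Bijective (fderiv ℝ (fun k => Φ (z.1, k)) z.2)

/-- Two realisations `Z`, `Y` of the same bracket relations, with `Z` independent at `p₀`, admit
locally a family of smooth maps that relate `Z` to `Y`. -/
theorem exists_local_related_family (Z : V → W →L[ℝ] V) (hZ : ContDiff ℝ ∞ Z)
    (Y : M → W →L[ℝ] M) (hY : ContDiff ℝ ∞ Y) (B : W →L[ℝ] W →L[ℝ] W)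
    (hBZ : ∀ q u v, fderiv ℝ Z q (Z q u) v - fderiv ℝ Z q (Z q v) u = Z q (B u v))
    (hBY : ∀ q u v, fderiv ℝ Y q (Y q u) v - fderiv ℝ Y q (Y q v) u = Y q (B u v))
    (p₀ : V) (hinj : Function.Injective (Z p₀)) (x₀ : M) :
    ∃ (A : Set V) (ε : ℝ) (Φ : V × M → M) (O : Set (V × M)),
      ε ≤ 1 ∧ IsOpen O ∧ (p₀, x₀) ∈ O ∧
      IsRelatedFamily Z Y (A ×ˢ Metric.ball x₀ ε) Φ ∧
      ∀ z ∈ O, z.1 ∈ A ∧ ∃ k ∈ Metric.ball x₀ ε, Φ (z.1, k) = z.2 := by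
  have : CompleteSpace V := FiniteDimensional.complete ℝ V
  have : CompleteSpace W := FiniteDimensional.complete ℝ W
  have : CompleteSpace M := FiniteDimensional.complete ℝ M
  obtain ⟨A, τ, hA, hp₀, hτ, hτ₀, hAτ⟩ := exists_local_group_parameter Z hZ B hBZ p₀ hinj
  obtain ⟨s, G, hs, hs₀, hG, hid, hflow⟩ := exists_smooth_flow Y hY B hBY x₀
  let ι : V × M → W × M := fun z => (τ z.1, z.2)
  have hι : ContDiffOn ℝ ∞ ι (A ×ˢ Set.univ) :=
    (hτ.comp contDiff_fst.contDiffOn fun z hz => hz.1).prodMk contDiff_snd.contDiffOn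
  let T : Set (V × M) := (A ×ˢ Set.univ) ∩ ι ⁻¹' s
  have hT : IsOpen T := hι.continuousOn.isOpen_inter_preimage (hA.prod isOpen_univ) hs
  let Φ : V × M → M := fun z => G (ι z)
  have hΦ : ContDiffOn ℝ ∞ Φ T := hG.comp (hι.mono Set.inter_subset_left) fun z hz => hz.2
  have hιd : ∀ z ∈ T, HasFDerivAt ι (((fderiv ℝ τ z.1).comp (ContinuousLinearMap.fst ℝ V M)).prod
      (ContinuousLinearMap.snd ℝ V M)) z := by
    intro z hz
    have h1 : HasFDerivAt τ (fderiv ℝ τ z.1) z.1 :=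
      ((hτ.contDiffAt (hA.mem_nhds hz.1.1)).differentiableAt (by simp)).hasFDerivAt
    exact (h1.comp z hasFDerivAt_fst).prodMk hasFDerivAt_snd
  have hΦd : ∀ z ∈ T, HasFDerivAt Φ ((fderiv ℝ G (ι z)).comp
      (((fderiv ℝ τ z.1).comp (ContinuousLinearMap.fst ℝ V M)).prod
        (ContinuousLinearMap.snd ℝ V M))) z := by
    intro z hz
    have h1 : HasFDerivAt G (fderiv ℝ G (ι z)) (ι z) :=
      ((hG.contDiffAt (hs.mem_nhds hz.2)).differentiableAt (by simp)).hasFDerivAt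
    exact h1.comp z (hιd z hz)
  have hι₀ : ι (p₀, x₀) = (0, x₀) := by simp [ι, hτ₀]
  have hz₀ : (p₀, x₀) ∈ T := ⟨⟨hp₀, Set.mem_univ _⟩, by rw [Set.mem_preimage, hι₀]; exact hs₀⟩
  -- One local inversion of the fibred map gives both an open set of reachable pairs and
  -- invertibility of `∂Φ/∂k`.
  let Ψ : V × M → V × M := fun z => (z.1, Φ z)
  have hΨ : ContDiffOn ℝ ∞ Ψ T := contDiff_fst.contDiffOn.prodMk hΦ
  have hΨd : ∀ z ∈ T, HasFDerivAt Ψ ((ContinuousLinearMap.fst ℝ V M).prod (fderiv ℝ Φ z)) z :=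
    fun z hz => hasFDerivAt_fst.prodMk (hΦd z hz).differentiableAt.hasFDerivAt
  set L := fderiv ℝ Φ (p₀, x₀) with hL
  have hL1 : ∀ d : V × M, L d = L (d.1, 0) + d.2 := by
    intro d
    have h1 := fderiv_flow_snd hs (hG.differentiableOn (by simp)) hid hs₀ d.2
    have h2 : L (0, d.2) = d.2 := by
      rw [hL, (hΦd _ hz₀).fderiv, hι₀]
      simpa using h1
    conv_lhs => rw [show d = (d.1, 0) + (0, d.2) by simp]
    rw [map_add, h2]
  let e : (V × M) ≃L[ℝ] V × M :=
    ContinuousLinearEquiv.equivOfInverse ((ContinuousLinearMap.fst ℝ V M).prod L)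
      ((ContinuousLinearMap.fst ℝ V M).prod (ContinuousLinearMap.snd ℝ V M -
        L.comp ((ContinuousLinearMap.inl ℝ V M).comp (ContinuousLinearMap.fst ℝ V M))))
      (fun d => by
        refine Prod.ext rfl ?_
        change L d - L (d.1, 0) = d.2
        rw [hL1 d, add_sub_cancel_left])
      (fun d => by
        refine Prod.ext rfl ?_
        change L (d.1, d.2 - L (d.1, 0)) = d.2
        rw [hL1]
        exact add_sub_cancel _ _)
  obtain ⟨φ, hφ, hz₀φ, hsub, -, hinv⟩ := exists_openPartialHomeomorph_of_contDiffOn hT hΨ hz₀ e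
    (hΨd _ hz₀).fderiv
  obtain ⟨A', C', hA', hpA', hC', hxC', hAC'⟩ :=
    mem_nhds_prod_iff'.1 (φ.open_source.mem_nhds hz₀φ)
  obtain ⟨ε', hε', hball⟩ := Metric.isOpen_iff.1 hC' x₀ hxC'
  let ε := min ε' 1
  have hε : 0 < ε := lt_min hε' one_pos
  set C := Metric.ball x₀ ε
  have hC : IsOpen C := Metric.isOpen_ball
  have hAC : A' ×ˢ C ⊆ φ.source := (Set.prod_mono subset_rfl
    ((Metric.ball_subset_ball (min_le_left _ _)).trans hball)).trans hAC'
  refine ⟨A', ε, Φ, φ '' (A' ×ˢ C), min_le_right _ _,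
    φ.isOpen_image_of_subset_source (hA'.prod hC) hAC,
    ⟨(p₀, x₀), ⟨hpA', Metric.mem_ball_self hε⟩, ?_⟩,
    ⟨hA'.prod hC, hΦ.mono (hAC.trans hsub), ?_, ?_⟩, ?_⟩
  · rw [hφ]
    refine Prod.ext rfl ?_
    change G (ι (p₀, x₀)) = x₀
    rw [hι₀, hid x₀ hs₀]
  · intro z hz a
    have hzT := hsub (hAC hz)
    obtain ⟨hsurj, hτz⟩ := hAτ z.1 hzT.1.1
    -- Writing `a = M(τ) v` makes `τ` carry the field `Z a` to the direction `v`, and the flow `G`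
    -- carries `v` to `Y a`.
    obtain ⟨v, rfl⟩ := hsurj a
    rw [(hΦd z hzT).fderiv]
    change fderiv ℝ G (ι z)
      (fderiv ℝ τ z.1 (Z z.1 (expPrimitive (B (τ z.1)) 1 v)), 0) = _
    rw [hτz v]
    exact hflow _ hzT.2 v
  · intro z hz
    have hzT := hsub (hAC hz)
    obtain ⟨e', he'⟩ := hinv z (hAC hz)
    rw [(hΨd z hzT).fderiv] at he'
    have h1 : HasFDerivAt (fun k => Φ (z.1, k))
        ((fderiv ℝ Φ z).comp (ContinuousLinearMap.inr ℝ V M)) z.2 :=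
      HasFDerivAt.comp z.2 (f := fun k => (z.1, k)) (hΦd z hzT).differentiableAt.hasFDerivAt
        (hasFDerivAt_prodMk_right z.1 z.2)
    rw [h1.fderiv]
    constructor
    · rw [injective_iff_map_eq_zero]
      intro k hk
      have h2 : e' (0, k) = 0 := by
        rw [← ContinuousLinearEquiv.coe_coe, ← he']
        exact Prod.ext rfl hk
      rw [map_eq_zero_iff _ e'.injective] at h2
      exact congrArg Prod.snd h2
    · intro y
      obtain ⟨d, hd⟩ := e'.surjective (0, y)
      rw [← ContinuousLinearEquiv.coe_coe, ← he'] at hd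
      have hd1 : d.1 = 0 := congrArg Prod.fst hd
      have hd2 : fderiv ℝ Φ z d = y := congrArg Prod.snd hd
      have hd3 : d = (0, d.2) := Prod.ext hd1 rfl
      rw [hd3] at hd2
      exact ⟨d.2, hd2⟩
  · rintro _ ⟨z, hz, rfl⟩
    rw [hφ]
    exact ⟨hz.1, z.2, hz.2, rfl⟩

end LocalRule

/-! ### Gluing local rules -/

section Gluing

universe u

variable {V W M : Type u} [NormedAddCommGroup V] [NormedSpace ℝ V]
  [NormedAddCommGroup W] [NormedSpace ℝ W] [NormedAddCommGroup M] [NormedSpace ℝ M]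

theorem IsRelatedFamily.congr {Z : V → W →L[ℝ] V} {Y : M → W →L[ℝ] M} {D : Set (V × M)}
    {Φ Ψ : V × M → M} (h : IsRelatedFamily Z Y D Φ) (hΨ : Set.EqOn Ψ Φ D) :
    IsRelatedFamily Z Y D Ψ := by
  have hev : ∀ z ∈ D, Ψ =ᶠ[𝓝 z] Φ := fun z hz => hΨ.eventuallyEq_of_mem (h.isOpen.mem_nhds hz)
  refine ⟨h.isOpen, h.contDiffOn.congr hΨ, fun z hz a => ?_, fun z hz => ?_⟩
  · rw [(hev z hz).fderiv_eq, hΨ hz, h.related z hz]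
  · have hev' : (fun k => Ψ (z.1, k)) =ᶠ[𝓝 z.2] fun k => Φ (z.1, k) := by
      have hc : ContinuousAt (fun k : M => (z.1, k)) z.2 := by fun_prop
      exact hc.eventually (hev z hz)
    rw [hev'.fderiv_eq]
    exact h.bijective z hz

theorem IsRelatedFamily.translate {Z : V → W →L[ℝ] V} {Y : M → W →L[ℝ] M} {A : Set V} {x c : M}
    {ε : ℝ} {Φ : V × M → M} (h : IsRelatedFamily Z Y (A ×ˢ Metric.ball x ε) Φ) :
    IsRelatedFamily Z Y (A ×ˢ Metric.ball c ε) (fun z => Φ (z + (0, x - c))) := by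
  have hmem : ∀ z : V × M, z ∈ A ×ˢ Metric.ball c ε ↔ z + (0, x - c) ∈ A ×ˢ Metric.ball x ε := by
    intro z
    simp only [Set.mem_prod, Prod.fst_add, Prod.snd_add, add_zero, mem_ball_iff_norm]
    rw [show z.2 + (x - c) - x = z.2 - c by abel]
  have hcont : ContDiff ℝ ∞ fun z : V × M => z + (0, x - c) := contDiff_id.add contDiff_const
  refine ⟨?_, h.contDiffOn.comp hcont.contDiffOn fun z hz => (hmem z).1 hz, fun z hz a => ?_,
    fun z hz => ?_⟩
  · rw [show A ×ˢ Metric.ball c ε = (fun z : V × M => z + (0, x - c)) ⁻¹' (A ×ˢ Metric.ball x ε)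
      from Set.ext hmem]
    exact h.isOpen.preimage hcont.continuous
  · rw [fderiv_comp_add_right]
    have := h.related _ ((hmem z).1 hz) a
    simpa using this
  · have := h.bijective _ ((hmem z).1 hz)
    rw [Prod.snd_add, Prod.fst_add, add_zero] at this
    have h2 := fderiv_comp_add_right (𝕜 := ℝ) (f := fun k => Φ (z.1, k)) (x := z.2) (x - c)
    simp only [Prod.add_def, add_zero]
    rw [h2]
    exact this

/-- Local families of related maps can be glued, by placing their parameters in disjoint balls. -/
theorem exists_related_family_of_local [SecondCountableTopology V] [SecondCountableTopology M]
    [Nontrivial M] (Z : V → W →L[ℝ] V) (Y : M → W →L[ℝ] M) (U : Set V)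
    (h : ∀ p ∈ U, ∀ x : M, ∃ (A : Set V) (ε : ℝ) (Φ : V × M → M) (O : Set (V × M)),
      ε ≤ 1 ∧ IsOpen O ∧ (p, x) ∈ O ∧ IsRelatedFamily Z Y (A ×ˢ Metric.ball x ε) Φ ∧
      ∀ z ∈ O, z.1 ∈ A ∧ ∃ k ∈ Metric.ball x ε, Φ (z.1, k) = z.2) :
    ∃ (D : Set (V × M)) (Φ : V × M → M), IsRelatedFamily Z Y D Φ ∧
      ∀ p ∈ U, ∀ x, ∃ k, (p, k) ∈ D ∧ Φ (p, k) = x := by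
  classical
  choose A ε Φ O hε hO hmem hrel hsurj using
    fun i : U × M => h i.1 i.1.2 i.2
  -- The Lindelöf property leaves countably many local rules, which can be numbered by `f`.
  obtain ⟨T, hT, hcover⟩ := TopologicalSpace.isOpen_iUnion_countable O hO
  obtain ⟨f, hf⟩ := Set.countable_iff_exists_injOn.1 hT
  obtain ⟨v, hv⟩ := exists_norm_eq M zero_le_one
  -- Centres spaced by `3` on a line, with radii at most `1`, give disjoint balls; this uses a
  -- nonzero vector in `M`.
  let c : U × M → M := fun i => (3 * (f i : ℝ)) • v
  let D : U × M → Set (V × M) := fun i => A i ×ˢ Metric.ball (c i) (ε i)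
  let Ψ : U × M → V × M → M := fun i z => Φ i (z + (0, i.2 - c i))
  have hΨ : ∀ i, IsRelatedFamily Z Y (D i) (Ψ i) := fun i => (hrel i).translate
  have huniq : ∀ i ∈ T, ∀ j ∈ T, ∀ z ∈ D i, z ∈ D j → i = j := by
    intro i hi j hj z hzi hzj
    by_contra hij
    have hne : f i ≠ f j := fun h => hij (hf hi hj h)
    have h1 : ‖c i - c j‖ < 2 := by
      calc ‖c i - c j‖ = dist (c i) (c j) := (dist_eq_norm _ _).symm
        _ ≤ dist z.2 (c i) + dist z.2 (c j) := dist_triangle_left _ _ _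
        _ < ε i + ε j := add_lt_add hzi.2 hzj.2
        _ ≤ 1 + 1 := add_le_add (hε i) (hε j)
        _ = 2 := by norm_num
    rw [← sub_smul, norm_smul, hv, mul_one, ← mul_sub, norm_mul, Real.norm_eq_abs,
      Real.norm_eq_abs, abs_of_pos (by norm_num : (0 : ℝ) < 3)] at h1
    have h2 : (1 : ℝ) ≤ |(f i : ℝ) - f j| := by
      have : (1 : ℤ) ≤ |(f i : ℤ) - f j| := Int.one_le_abs (sub_ne_zero.2 (by exact_mod_cast hne))
      exact_mod_cast this
    linarith
  let Θ : V × M → M := fun z => if hz : ∃ i ∈ T, z ∈ D i then Ψ hz.choose z else 0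
  have hΘ : ∀ i ∈ T, Set.EqOn Θ (Ψ i) (D i) := by
    intro i hi z hz
    have hex : ∃ i ∈ T, z ∈ D i := ⟨i, hi, hz⟩
    change (if hz : ∃ i ∈ T, z ∈ D i then Ψ hz.choose z else 0) = _
    rw [dif_pos hex, huniq _ hex.choose_spec.1 i hi z hex.choose_spec.2 hz]
  have hfam : ∀ i ∈ T, IsRelatedFamily Z Y (D i) Θ := fun i hi => (hΨ i).congr (hΘ i hi)
  have hD : ∀ z ∈ ⋃ i ∈ T, D i, ∃ i ∈ T, z ∈ D i := fun z hz => by simpa using hz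
  refine ⟨⋃ i ∈ T, D i, Θ, ⟨isOpen_biUnion fun i hi => (hfam i hi).isOpen, ?_, ?_, ?_⟩, ?_⟩
  · intro z hz
    obtain ⟨i, hi, hzi⟩ := hD z hz
    exact ((hfam i hi).contDiffOn.contDiffAt ((hfam i hi).isOpen.mem_nhds hzi)).contDiffWithinAt
  · intro z hz
    obtain ⟨i, hi, hzi⟩ := hD z hz
    exact (hfam i hi).related z hzi
  · intro z hz
    obtain ⟨i, hi, hzi⟩ := hD z hz
    exact (hfam i hi).bijective z hzi
  · intro p hp x
    have h1 : (p, x) ∈ ⋃ i ∈ T, O i := by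
      rw [hcover]
      exact Set.mem_iUnion.2 ⟨(⟨p, hp⟩, x), hmem (⟨p, hp⟩, x)⟩
    simp only [Set.mem_iUnion] at h1
    obtain ⟨i, hi, hzi⟩ := h1
    obtain ⟨hpA, k, hk, hkx⟩ := hsurj i _ hzi
    have hk' : (p, k - i.2 + c i) ∈ D i := by
      refine ⟨hpA, ?_⟩
      rw [mem_ball_iff_norm, add_sub_cancel_right]
      exact mem_ball_iff_norm.1 hk
    refine ⟨k - i.2 + c i, Set.mem_biUnion hi hk', ?_⟩
    rw [hΘ i hi hk']
    refine Eq.trans (congrArg (Φ i) ?_) hkx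
    refine Prod.ext (add_zero _) ?_
    change k - i.2 + c i + (i.2 - c i) = k
    abel

end Gluing

/-! ### Solutions of the system -/

section Solutions

variable {n m : ℕ}

theorem exists_isSolutionOn {X : ℝ → E n → E n}
    (hX : ContDiff ℝ ∞ (fun p : ℝ × E n => X p.1 p.2)) (t₀ : ℝ) (x₀ : E n) :
    ∃ ε > 0, ∃ x : ℝ → E n, x t₀ = x₀ ∧ IsSolutionOn X (Set.Ioo (t₀ - ε) (t₀ + ε)) x := by
  -- Adding time as a coordinate makes the system autonomous; `h1` checks that this coordinate is
  -- the time `t`.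
  let f : ℝ × E n → ℝ × E n := fun p => (1, X p.1 p.2)
  have hf : ContDiff ℝ 1 f := contDiff_const.prodMk (hX.of_le (by exact_mod_cast le_top))
  obtain ⟨α, hα₀, ε, hε, hα⟩ :=
    hf.contDiffAt.exists_forall_mem_closedBall_exists_eq_forall_mem_Ioo_hasDerivAt₀
      (x₀ := (t₀, x₀)) t₀
  have h1 : ∀ t ∈ Set.Ioo (t₀ - ε) (t₀ + ε), (α t).1 = t := by
    have hd : ∀ t ∈ Set.Ioo (t₀ - ε) (t₀ + ε), HasDerivAt (fun t => (α t).1 - t) 0 t := by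
      intro t ht
      have := (hasFDerivAt_fst (𝕜 := ℝ) (p := α t)).comp_hasDerivAt t (hα t ht)
      exact (this.sub (hasDerivAt_id t)).congr_deriv (sub_self _)
    intro t ht
    have := (convex_Ioo (t₀ - ε) (t₀ + ε)).is_const_of_fderivWithin_eq_zero (𝕜 := ℝ)
      (f := fun t => (α t).1 - t)
      (fun t ht => (hd t ht).differentiableAt.differentiableWithinAt)
      (fun t ht => by
        rw [fderivWithin_of_isOpen isOpen_Ioo ht]
        ext
        simpa using (hd t ht).deriv)
      ht (y := t₀) ⟨by linarith, by linarith⟩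
    simp only [hα₀, sub_self] at this
    linarith
  refine ⟨ε, hε, fun t => (α t).2, by simp [hα₀], fun t ht => ?_⟩
  have := (hasFDerivAt_snd (𝕜 := ℝ) (p := α t)).comp_hasDerivAt t (hα t ht)
  refine this.congr_deriv ?_
  change X (α t).1 (α t).2 = _
  rw [h1 t ht]

theorem IsSolutionOn.mono {X : ℝ → E n → E n} {I J : Set ℝ} {x : ℝ → E n}
    (h : IsSolutionOn X I x) (hJ : J ⊆ I) : IsSolutionOn X J x :=
  fun t ht => h t (hJ ht)

theorem eventuallyEq_of_solutions {X : ℝ → E n → E n}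
    (hX : ContDiff ℝ ∞ (fun p : ℝ × E n => X p.1 p.2)) {t₀ : ℝ} {x y : ℝ → E n}
    (hx : ∀ᶠ t in 𝓝 t₀, HasDerivAt x (X t (x t)) t)
    (hy : ∀ᶠ t in 𝓝 t₀, HasDerivAt y (X t (y t)) t) (h₀ : x t₀ = y t₀) : x =ᶠ[𝓝 t₀] y := by
  obtain ⟨K, s, hs, hK⟩ := (hX.contDiffAt (x := (t₀, x t₀))).of_le
    (show (1 : WithTop ℕ∞) ≤ ∞ by exact_mod_cast le_top) |>.exists_lipschitzOnWith
  have hmem : ∀ z : ℝ → E n, z t₀ = x t₀ → (∀ᶠ t in 𝓝 t₀, HasDerivAt z (X t (z t)) t) →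
      ∀ᶠ t in 𝓝 t₀, HasDerivAt z (X t (z t)) t ∧ z t ∈ {y | (t, y) ∈ s} := by
    intro z hz₀ hz
    refine hz.and ?_
    have hc : ContinuousAt (fun t => (t, z t)) t₀ :=
      continuousAt_id.prodMk hz.self_of_nhds.continuousAt
    exact hc.preimage_mem_nhds (by rw [hz₀]; exact hs)
  refine ODE_solution_unique_of_eventually (v := X) (K := K) (s := fun t => {y | (t, y) ∈ s})
    (Filter.Eventually.of_forall fun t => ?_) (hmem x rfl hx) (hmem y h₀.symm hy) h₀
  intro y hy z hz
  have := hK hy hz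
  simpa [Prod.edist_eq] using this

theorem hasDerivAt_pi_solution {X : ℝ → E n → E n} {I : Set ℝ} {x : Fin m → ℝ → E n}
    (hx : ∀ i, IsSolutionOn X I (x i)) {t : ℝ} (ht : t ∈ I) :
    HasDerivAt (fun t i => x i t) (diagonalProlongation m (X t) fun i => x i t) t :=
  hasDerivAt_pi.2 fun i => hx i t ht

/-- A smooth map that relates the prolongation of the system to the system, and reaches every point
of `ℝⁿ` from every `m`-tuple in `U`, is a superposition rule. -/
theorem isSuperpositionRule_of_related {X : ℝ → E n → E n}
    (hX : ContDiff ℝ ∞ (fun p : ℝ × E n => X p.1 p.2)) {U : Set (Fin m → E n)}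
    {D : Set ((Fin m → E n) × E n)} {Φ : (Fin m → E n) × E n → E n} (hD : IsOpen D)
    (hΦ : ContDiffOn ℝ ∞ Φ D)
    (hrel : ∀ z ∈ D, ∀ t, fderiv ℝ Φ z (diagonalProlongation m (X t) z.1, 0) = X t (Φ z))
    (hsurj : ∀ p ∈ U, ∀ x, ∃ k, (p, k) ∈ D ∧ Φ (p, k) = x) :
    IsSuperpositionRule X U D Φ := by
  have hsol : ∀ (I : Set ℝ) (x : Fin m → ℝ → E n) (k : E n), (∀ i, IsSolutionOn X I (x i)) →
      ∀ t ∈ I, ((fun i => x i t), k) ∈ D →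
      HasDerivAt (fun t => Φ ((fun i => x i t), k)) (X t (Φ ((fun i => x i t), k))) t := by
    intro I x k hx t ht hz
    have h1 := (hΦ.contDiffAt (hD.mem_nhds hz)).differentiableAt (by simp) |>.hasFDerivAt
    have h2 : HasDerivAt (fun t => Φ ((fun i => x i t), k)) _ t :=
      HasFDerivAt.comp_hasDerivAt t h1
        ((hasDerivAt_pi_solution hx ht).prodMk (hasDerivAt_const t k))
    exact h2.congr_deriv (hrel _ hz t)
  refine ⟨hD, hΦ, fun a b x k hx hz t ht => hsol _ x k hx t ht (hz t ht), ?_⟩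
  intro a b t₀ ht₀ x y hx hy hU
  obtain ⟨k, hk, hky⟩ := hsurj _ hU (y t₀)
  refine ⟨k, ?_⟩
  have hI : Set.Ioo a b ∈ 𝓝 t₀ := isOpen_Ioo.mem_nhds ht₀
  have hc : ContinuousAt (fun t => ((fun i => x i t), k)) t₀ :=
    (hasDerivAt_pi_solution hx ht₀).continuousAt.prodMk continuousAt_const
  have hDe : ∀ᶠ t in 𝓝 t₀, ((fun i => x i t), k) ∈ D := hc.preimage_mem_nhds (hD.mem_nhds hk)
  have heq := eventuallyEq_of_solutions hX (Filter.eventually_of_mem hI hy)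
    (hDe.and hI |>.mono fun t ht => hsol _ x k hx t ht.2 ht.1) hky.symm
  exact hDe.and heq

end Solutions

/-! ### Prolongations and the rule attached to a decomposition -/

section Prolongation

/-- The linear map `a ↦ ∑ α, a_α Z_α(q)` attached to a family of vector fields. -/
noncomputable def combinationMap {F : Type*} [NormedAddCommGroup F] [NormedSpace ℝ F] {r : ℕ}
    (Z : Fin r → F → F) (q : F) : (Fin r → ℝ) →L[ℝ] F :=
  ∑ α, (ContinuousLinearMap.proj α : (Fin r → ℝ) →L[ℝ] ℝ).smulRight (Z α q)

variable {F : Type*} [NormedAddCommGroup F] [NormedSpace ℝ F] {r : ℕ} {Z : Fin r → F → F}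

@[simp]
theorem combinationMap_apply (Z : Fin r → F → F) (q : F) (a : Fin r → ℝ) :
    combinationMap Z q a = ∑ α, a α • Z α q := by
  simp [combinationMap]

theorem combinationMap_injective {q : F} (h : LinearIndependent ℝ fun α => Z α q) :
    Function.Injective (combinationMap Z q) := by
  rw [injective_iff_map_eq_zero]
  intro a ha
  rw [combinationMap_apply] at ha
  exact funext (Fintype.linearIndependent_iff.1 h a ha)

theorem contDiff_combinationMap (hZ : ∀ α, ContDiff ℝ ∞ (Z α)) :
    ContDiff ℝ ∞ (combinationMap Z) := by
  unfold combinationMap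
  exact ContDiff.sum fun α _ => contDiff_const.smulRight (hZ α)

theorem fderiv_combinationMap_apply (hZ : ∀ α, ContDiff ℝ ∞ (Z α)) (q d : F) (a : Fin r → ℝ) :
    fderiv ℝ (combinationMap Z) q d a = ∑ α, a α • fderiv ℝ (Z α) q d := by
  have h1 : HasFDerivAt (fun q => combinationMap Z q a)
      ((fderiv ℝ (combinationMap Z) q).flip a) q := by
    have h := ((contDiff_combinationMap hZ).differentiable (by simp) q).hasFDerivAt.clm_apply
      (hasFDerivAt_const a q)
    refine h.congr_fderiv ?_
    ext d
    simp
  have h2 : HasFDerivAt (fun q => combinationMap Z q a) (∑ α, a α • fderiv ℝ (Z α) q) q := by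
    simp only [combinationMap_apply]
    exact HasFDerivAt.fun_sum fun α _ =>
      ((hZ α).differentiable (by simp) q).hasFDerivAt.const_smul (a α)
  have h3 := congrArg (fun A : F →L[ℝ] F => A d) (h1.unique h2)
  simpa using h3

/-- The bilinear map with structure constants `c`. -/
noncomputable def structureMap (c : Fin r → Fin r → Fin r → ℝ) :
    (Fin r → ℝ) →L[ℝ] (Fin r → ℝ) →L[ℝ] Fin r → ℝ :=
  ∑ δ, (ContinuousLinearMap.proj δ : (Fin r → ℝ) →L[ℝ] ℝ).smulRight
    (∑ α, (ContinuousLinearMap.proj α : (Fin r → ℝ) →L[ℝ] ℝ).smulRight (c δ α))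

theorem structureMap_apply (c : Fin r → Fin r → Fin r → ℝ) (u v : Fin r → ℝ) :
    structureMap c u v = ∑ δ, ∑ α, (u δ * v α) • c δ α := by
  simp [structureMap, Finset.smul_sum, smul_smul]

theorem bracket_combinationMap (hZ : ∀ α, ContDiff ℝ ∞ (Z α)) (c : Fin r → Fin r → Fin r → ℝ)
    (hc : ∀ δ α q, VectorField.lieBracket ℝ (Z δ) (Z α) q = ∑ γ, c δ α γ • Z γ q)
    (q : F) (u v : Fin r → ℝ) :
    fderiv ℝ (combinationMap Z) q (combinationMap Z q u) v -
      fderiv ℝ (combinationMap Z) q (combinationMap Z q v) u =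
      combinationMap Z q (structureMap c u v) := by
  have h1 : combinationMap Z q (structureMap c u v) =
      ∑ δ, ∑ α, (u δ * v α) • VectorField.lieBracket ℝ (Z δ) (Z α) q := by
    rw [structureMap_apply, map_sum]
    refine Finset.sum_congr rfl fun δ _ => ?_
    rw [map_sum]
    refine Finset.sum_congr rfl fun α _ => ?_
    rw [map_smul, hc, combinationMap_apply]
  rw [h1, fderiv_combinationMap_apply hZ, fderiv_combinationMap_apply hZ]
  simp only [combinationMap_apply, map_sum, map_smul, VectorField.lieBracket, smul_sub,
    Finset.sum_sub_distrib, Finset.smul_sum, smul_smul]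
  congr 1
  · rw [Finset.sum_comm]
    exact Finset.sum_congr rfl fun δ _ => Finset.sum_congr rfl fun α _ => by rw [mul_comm]

variable {n m : ℕ}

theorem contDiff_diagonalProlongation {Y : E n → E n} (hY : ContDiff ℝ ∞ Y) :
    ContDiff ℝ ∞ (diagonalProlongation m Y) :=
  contDiff_pi.2 fun i => hY.comp (contDiff_apply ℝ (E n) i)

theorem fderiv_diagonalProlongation_apply {Y : E n → E n} (hY : Differentiable ℝ Y)
    (p d : Fin m → E n) (i : Fin m) :
    fderiv ℝ (diagonalProlongation m Y) p d i = fderiv ℝ Y (p i) (d i) := by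
  have h : HasFDerivAt (diagonalProlongation m Y)
      (ContinuousLinearMap.pi fun i => (fderiv ℝ Y (p i)).comp (ContinuousLinearMap.proj i)) p :=
    hasFDerivAt_pi.2 fun i => (hY (p i)).hasFDerivAt.comp p
      (ContinuousLinearMap.proj (R := ℝ) (φ := fun _ : Fin m => E n) i).hasFDerivAt
  rw [h.fderiv]
  rfl

/-- The diagonal prolongation commutes with the Lie bracket. -/
theorem lieBracket_diagonalProlongation {Y W : E n → E n} (hY : Differentiable ℝ Y)
    (hW : Differentiable ℝ W) :
    VectorField.lieBracket ℝ (diagonalProlongation m Y) (diagonalProlongation m W) =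
      diagonalProlongation m (VectorField.lieBracket ℝ Y W) := by
  ext1 p
  ext1 i
  simp only [VectorField.lieBracket, Pi.sub_apply, fderiv_diagonalProlongation_apply hY,
    fderiv_diagonalProlongation_apply hW]
  rfl

theorem IsLieAlgebraBasis.exists_structure_constants {Y : Fin r → E n → E n}
    (hY : IsLieAlgebraBasis Y) : ∃ c : Fin r → Fin r → Fin r → ℝ,
      ∀ δ α, VectorField.lieBracket ℝ (Y δ) (Y α) = ∑ γ, c δ α γ • Y γ := by
  choose c hc using fun δ α =>
    (Submodule.mem_span_range_iff_exists_fun ℝ).1 (hY.lieBracket_mem δ α)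
  exact ⟨c, fun δ α => (hc δ α).symm⟩

theorem IsLieAlgebraBasis.exists_related_family (hn : n ≠ 0) {Y : Fin r → E n → E n}
    (hY : IsLieAlgebraBasis Y) (U : Set (Fin m → E n))
    (hU : ∀ p ∈ U, LinearIndependent ℝ fun α => diagonalProlongation m (Y α) p) :
    ∃ (D : Set ((Fin m → E n) × E n)) (Φ : (Fin m → E n) × E n → E n),
      IsRelatedFamily (combinationMap fun α => diagonalProlongation m (Y α)) (combinationMap Y)
        D Φ ∧ ∀ p ∈ U, ∀ x, ∃ k, (p, k) ∈ D ∧ Φ (p, k) = x := by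
  obtain ⟨c, hc⟩ := hY.exists_structure_constants
  have : NeZero n := ⟨hn⟩
  have hYd : ∀ α, Differentiable ℝ (Y α) := fun α => (hY.contDiff α).differentiable (by simp)
  have hZ : ∀ α, ContDiff ℝ ∞ (diagonalProlongation m (Y α)) := fun α =>
    contDiff_diagonalProlongation (hY.contDiff α)
  refine exists_related_family_of_local _ _ U fun p hp x =>
    exists_local_related_family _ (contDiff_combinationMap hZ) _
      (contDiff_combinationMap hY.contDiff) (structureMap c)
      (bracket_combinationMap hZ c fun δ α q => ?_)
      (bracket_combinationMap hY.contDiff c fun δ α q => ?_) p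
      (combinationMap_injective (hU p hp)) x
  · rw [lieBracket_diagonalProlongation (hYd δ) (hYd α), hc]
    ext1 i
    simp [diagonalProlongation, Finset.sum_apply]
  · rw [hc]
    simp [Finset.sum_apply]

/-- A decomposition yields a superposition rule for the `m`-tuples at which the prolongations are
linearly independent, and this rule is locally invertible in the constants. -/
theorem exists_isSuperpositionRule {X : ℝ → E n → E n}
    (hX : ContDiff ℝ ∞ (fun p : ℝ × E n => X p.1 p.2)) {Y : Fin r → E n → E n}
    {b : Fin r → ℝ → ℝ} (hY : IsLieAlgebraBasis Y) (hb : IsDecomposition X Y b)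
    (U : Set (Fin m → E n))
    (hU : ∀ p ∈ U, LinearIndependent ℝ fun α => diagonalProlongation m (Y α) p) :
    ∃ (D : Set ((Fin m → E n) × E n)) (Φ : (Fin m → E n) × E n → E n),
      IsSuperpositionRule X U D Φ ∧
      ∀ z ∈ D, Function.Bijective (fderiv ℝ (fun k : E n => Φ (z.1, k)) z.2) := by
  rcases eq_or_ne n 0 with rfl | hn
  -- In dimension `0` there is no room to separate parameter balls, but every equation holds
  -- trivially.
  · refine ⟨Set.univ, fun _ => 0, isSuperpositionRule_of_related hX isOpen_univ
      contDiffOn_const (fun z _ t => Subsingleton.elim _ _)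
      (fun p _ x => ⟨0, Set.mem_univ _, Subsingleton.elim _ _⟩), fun z _ => ?_⟩
    exact ⟨Function.injective_of_subsingleton _, fun y => ⟨0, Subsingleton.elim _ _⟩⟩
  · obtain ⟨D, Φ, hrel, hsurj⟩ := hY.exists_related_family hn U hU
    refine ⟨D, Φ, isSuperpositionRule_of_related hX hrel.isOpen hrel.contDiffOn
      (fun z hz t => ?_) hsurj, hrel.bijective⟩
    have h := hrel.related z hz fun α => b α t
    rw [combinationMap_apply, combinationMap_apply] at h
    rw [hb.2, ← h]
    congr 2
    ext1 i
    simp [diagonalProlongation, hb.2, Finset.sum_apply]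

end Prolongation

/-! ### Independence at a generic point -/

section GenericPoint

variable {F : Type*} [NormedAddCommGroup F] [NormedSpace ℝ F] {r : ℕ} {Z : Fin r → F → F}

/-- A nonzero coefficient stays nonzero on an open set, which meets the dense set of pointwise
independence. -/
theorem linearIndependentAtGenericPoint_of_dense
    (h : Dense {p | LinearIndependent ℝ fun α => Z α p}) : LinearIndependentAtGenericPoint Z := by
  intro O hO f hf hsum α p hp
  have hcont : ContinuousOn (f α) O := (hf α).continuousOn
  by_contra hne
  have hopen : IsOpen (O ∩ f α ⁻¹' {0}ᶜ) :=
    hcont.isOpen_inter_preimage hO isOpen_compl_singleton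
  obtain ⟨q, ⟨hqO, hq⟩, hqi⟩ := h.inter_open_nonempty _ hopen ⟨p, hp, hne⟩
  exact hq (Fintype.linearIndependent_iff.1 hqi (fun α => f α q) (hsum q hqO) α)

theorem isOpen_setOf_linearIndependent_fields (hZ : ∀ α, Continuous (Z α)) {ι : Type*} [Finite ι]
    (j : ι → Fin r) : IsOpen {p | LinearIndependent ℝ fun i => Z (j i) p} :=
  isOpen_setOfPred_linearIndependent.preimage (continuous_pi fun i => hZ (j i))

/-- If `Z_α` depends linearly on an independent subfamily along an open set, then it is locally
a combination of the subfamily with smooth coefficients. -/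
theorem exists_smooth_coefficients [FiniteDimensional ℝ F] (hZ : ∀ α, ContDiff ℝ ∞ (Z α))
    {S : Finset (Fin r)} {α : Fin r} {O : Set F} (hO : IsOpen O) {p : F} (hp : p ∈ O)
    (hS : LinearIndependent ℝ fun i : S => Z i p)
    (hα : ∀ q ∈ O, Z α q ∈ Submodule.span ℝ (Set.range fun i : S => Z i q)) :
    ∃ (O' : Set F) (f : S → F → ℝ), IsOpen O' ∧ p ∈ O' ∧ O' ⊆ O ∧
      (∀ i, ContDiffOn ℝ ∞ (f i) O') ∧ ∀ q ∈ O', Z α q = ∑ i, f i q • Z i q := by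
  let A : F → (S → ℝ) →L[ℝ] F := fun q =>
    ∑ i, (ContinuousLinearMap.proj i : (S → ℝ) →L[ℝ] ℝ).smulRight (Z i q)
  have hA : ∀ q a, A q a = ∑ i, a i • Z i q := fun q a => by simp [A]
  have hAs : ContDiff ℝ ∞ A := ContDiff.sum fun i _ => contDiff_const.smulRight (hZ i)
  obtain ⟨ℓ, hℓ⟩ := LinearMap.exists_leftInverse_of_injective (A p : (S → ℝ) →ₗ[ℝ] F) (by
    rw [LinearMap.ker_eq_bot, injective_iff_map_eq_zero]
    intro a ha
    refine funext (Fintype.linearIndependent_iff.1 hS a ?_)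
    rw [← hA]
    exact ha)
  let L : F →L[ℝ] S → ℝ := LinearMap.toContinuousLinearMap ℓ
  -- With `L` a left inverse of `A p`, the operator `L ∘ A q` is invertible near `p`; the
  -- coefficients `K⁻¹ L Z_α` are smooth, as in Cramer's rule.
  let K : F → (S → ℝ) →L[ℝ] S → ℝ := fun q => L.comp (A q)
  have hK : ContDiff ℝ ∞ K := contDiff_const.clm_comp hAs
  have hKp : K p = 1 := by
    refine ContinuousLinearMap.ext fun a => ?_
    exact congrArg (fun T : (S → ℝ) →ₗ[ℝ] S → ℝ => T a) hℓ
  let O' : Set F := O ∩ K ⁻¹' {T | IsUnit T}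
  have hO' : IsOpen O' := hO.inter (Units.isOpen.preimage hK.continuous)
  refine ⟨O', fun i q => Ring.inverse (K q) (L (Z α q)) i, hO', ⟨hp, ?_⟩,
    Set.inter_subset_left, fun i q hq => ?_, fun q hq => ?_⟩
  · rw [Set.mem_preimage, hKp]
    exact isUnit_one
  · obtain ⟨T, hT⟩ := hq.2
    have h1 : ContDiffAt ℝ ∞ (fun q => Ring.inverse (K q)) q :=
      ContDiffAt.comp q (g := Ring.inverse) (f := K) (hT ▸ contDiffAt_ringInverse ℝ T)
        hK.contDiffAt
    have h2 : ContDiffAt ℝ ∞ (fun q => L (Z α q)) q :=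
      L.contDiff.contDiffAt.comp q (hZ α).contDiffAt
    exact (contDiffAt_pi.1 (h1.clm_apply h2) i).contDiffWithinAt
  · obtain ⟨a, ha⟩ := (Submodule.mem_span_range_iff_exists_fun ℝ).1 (hα q hq.1)
    have h1 : L (Z α q) = K q a := by
      change _ = L (A q a)
      rw [hA, ha]
    have h2 : Ring.inverse (K q) (L (Z α q)) = a := by
      rw [h1]
      change (Ring.inverse (K q) * K q) a = a
      rw [Ring.inverse_mul_cancel _ hq.2]
      rfl
    simp only [h2]
    exact ha.symm

theorem LinearIndependentAtGenericPoint.dense [FiniteDimensional ℝ F]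
    (hZ : ∀ α, ContDiff ℝ ∞ (Z α)) (h : LinearIndependentAtGenericPoint Z) :
    Dense {p | LinearIndependent ℝ fun α => Z α p} := by
  classical
  rw [dense_iff_inter_open]
  intro O hO hOne
  by_contra hempty
  have hdep : ∀ p ∈ O, ¬ LinearIndependent ℝ fun α => Z α p := fun p hp hli =>
    hempty ⟨p, hp, hli⟩
  -- A largest subfamily independent somewhere in `O`: wherever it is independent in `O`, every
  -- other field depends on it. This produces a smooth relation with coefficient `-1` at `α`.
  obtain ⟨S, hS, hmax⟩ := Finset.exists_max_image
    (Finset.univ.filter fun S : Finset (Fin r) =>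
      ∃ p ∈ O, LinearIndependent ℝ fun i : S => Z i p) Finset.card
    ⟨∅, by
      obtain ⟨p, hp⟩ := hOne
      exact Finset.mem_filter.2 ⟨Finset.mem_univ _, p, hp, linearIndependent_empty_type⟩⟩
  obtain ⟨p, hp, hSp⟩ := (Finset.mem_filter.1 hS).2
  obtain ⟨α, hα⟩ : ∃ α, α ∉ S := by
    by_contra! hall
    have hinj : Function.Injective fun α : Fin r => (⟨α, hall α⟩ : S) := fun a b hab =>
      congrArg Subtype.val hab
    exact hdep p hp (hSp.comp _ hinj)
  have hspan : ∀ q ∈ O ∩ {q | LinearIndependent ℝ fun i : S => Z i q},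
      Z α q ∈ Submodule.span ℝ (Set.range fun i : S => Z i q) := by
    rintro q ⟨hqO, hq⟩
    by_contra hnot
    have hli : LinearIndependent ℝ fun i : (insert α S : Finset (Fin r)) => Z i q := by
      have h1 : LinearIndepOn ℝ (fun i => Z i q) (S : Set (Fin r)) := hq
      have h2 := h1.insert (x := α) (by rwa [Set.image_eq_range])
      rw [← Finset.coe_insert] at h2
      exact h2
    have h3 := hmax (insert α S) (Finset.mem_filter.2 ⟨Finset.mem_univ _, q, hqO, hli⟩)
    rw [Finset.card_insert_of_notMem hα] at h3
    omega
  obtain ⟨O', f, hO', hpO', -, hf, hZα⟩ := exists_smooth_coefficients hZ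
    (hO.inter (isOpen_setOf_linearIndependent_fields (fun α => (hZ α).continuous)
      ((↑) : S → Fin r))) ⟨hp, hSp⟩ hSp hspan
  let g : Fin r → F → ℝ := fun β q =>
    if hβ : β ∈ S then f ⟨β, hβ⟩ q else if β = α then -1 else 0
  have hg := h O' hO' g (fun β => by
    by_cases hβ : β ∈ S
    · simpa [g, hβ] using hf ⟨β, hβ⟩
    · simpa [g, hβ] using contDiffOn_const) (fun q hq => by
    have h1 : ∑ β ∈ S, g β q • Z β q = Z α q := by
      rw [hZα q hq, ← Finset.sum_coe_sort S]
      exact Finset.sum_congr rfl fun i _ => by simp [g]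
    have h2 : ∑ β ∈ Sᶜ, g β q • Z β q = -Z α q := by
      rw [Finset.sum_eq_single α]
      · simp [g, hα]
      · intro β hβ hne
        simp [g, Finset.mem_compl.1 hβ, hne]
      · intro hα'
        exact absurd (Finset.mem_compl.2 hα) hα'
    rw [← Finset.sum_add_sum_compl S, h1, h2, add_neg_cancel]) α p hpO'
  simp [g, hα] at hg

end GenericPoint

/-! ### Separating constant-coefficient relations by points -/

section Separation

variable {n r : ℕ}

/-- The constant coefficient relations between the values of `Y` at the first `m` points. -/
noncomputable def relationsAt (Y : Fin r → E n → E n) (p : ℕ → E n) (m : ℕ) :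
    Submodule ℝ (Fin r → ℝ) :=
  ⨅ i : Fin m, LinearMap.ker (combinationMap Y (p i) : (Fin r → ℝ) →ₗ[ℝ] E n)

theorem mem_relationsAt {Y : Fin r → E n → E n} {p : ℕ → E n} {m : ℕ} {c : Fin r → ℝ} :
    c ∈ relationsAt Y p m ↔ ∀ i : Fin m, ∑ α, c α • Y α (p i) = 0 := by
  simp [relationsAt, Submodule.mem_iInf]

/-- Any surviving relation fails somewhere in the next set; adding such a point lowers the dimension
of the space of relations by at least one. -/
theorem exists_finrank_relationsAt_le (Y : Fin r → E n → E n) (O : ℕ → Set (E n))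
    (hO : ∀ i, (O i).Nonempty) (hY : ∀ i, LinearIndependent ℝ fun α (x : O i) => Y α x) (m : ℕ) :
    ∃ p : ℕ → E n, (∀ i, p i ∈ O i) ∧ Module.finrank ℝ (relationsAt Y p m) ≤ r - m := by
  induction m with
  | zero =>
    choose p hp using hO
    exact ⟨p, hp, (Submodule.finrank_le _).trans (by simp)⟩
  | succ m ih =>
    obtain ⟨p, hp, hrank⟩ := ih
    have hanti : ∀ q : ℕ → E n, (∀ i < m, q i = p i) →
        relationsAt Y q (m + 1) ≤ relationsAt Y p m := by
      intro q hq c hc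
      rw [mem_relationsAt] at hc ⊢
      intro i
      have := hc i.castSucc
      rwa [Fin.val_castSucc, hq i i.2] at this
    by_cases hbot : relationsAt Y p m = ⊥
    · refine ⟨p, hp, ?_⟩
      have h1 : relationsAt Y p (m + 1) = ⊥ := by
        rw [eq_bot_iff, ← hbot]
        exact hanti p fun _ _ => rfl
      rw [h1, finrank_bot]
      exact Nat.zero_le _
    · obtain ⟨c, hc, hc0⟩ := Submodule.exists_mem_ne_zero_of_ne_bot hbot
      obtain ⟨x, hx⟩ : ∃ x : O m, ∑ α, c α • Y α x ≠ 0 := by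
        by_contra! hall
        refine hc0 (funext (Fintype.linearIndependent_iff.1 (hY m) c ?_))
        ext1 x
        simpa [Finset.sum_apply] using hall x
      refine ⟨Function.update p m x, fun i => ?_, ?_⟩
      · rcases eq_or_ne i m with rfl | hi
        · simp
        · rw [Function.update_of_ne hi]
          exact hp i
      · have hlt : relationsAt Y (Function.update p m x) (m + 1) < relationsAt Y p m := by
          refine lt_of_le_of_ne
            (hanti _ fun i hi => Function.update_of_ne hi.ne _ _) fun heq => ?_
          rw [← heq, mem_relationsAt] at hc
          have := hc (Fin.last m)
          rw [Fin.val_last, Function.update_self] at this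
          exact hx this
        have := Submodule.finrank_lt_finrank_of_lt hlt
        omega

/-- If the fields are linearly independent over `ℝ` on each of `r` sets, then the values of the
`r`-th prolongations are linearly independent at some tuple from these sets. -/
theorem exists_linearIndependent_prolongation (Y : Fin r → E n → E n) (O : Fin r → Set (E n))
    (hO : ∀ i, (O i).Nonempty) (hY : ∀ i, LinearIndependent ℝ fun α (x : O i) => Y α x) :
    ∃ p : Fin r → E n, (∀ i, p i ∈ O i) ∧
      LinearIndependent ℝ fun α => diagonalProlongation r (Y α) p := by
  rcases Nat.eq_zero_or_pos r with rfl | hr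
  · exact ⟨Fin.elim0, fun i => i.elim0, linearIndependent_empty_type⟩
  · let g : ℕ → Fin r := fun i => if h : i < r then ⟨i, h⟩ else ⟨0, hr⟩
    have hg : ∀ i : Fin r, g i = i := fun i => by simp [g]
    obtain ⟨p, hp, hrank⟩ := exists_finrank_relationsAt_le Y (fun i => O (g i))
      (fun i => hO _) (fun i => hY _) r
    refine ⟨fun i => p i, fun i => by simpa [hg] using hp i, ?_⟩
    rw [Fintype.linearIndependent_iff]
    intro c hc
    have hbot : relationsAt Y p r = ⊥ := Submodule.finrank_eq_zero.1 (by omega)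
    have hmem : c ∈ relationsAt Y p r := mem_relationsAt.2 fun i => by
      simpa [diagonalProlongation, Finset.sum_apply] using congrFun hc i
    rw [hbot, Submodule.mem_bot] at hmem
    exact congrFun hmem

theorem dense_linearIndependent_prolongation {Y : Fin r → E n → E n}
    (hY : LinearIndependentOnOpens Y) :
    Dense {p : Fin r → E n | LinearIndependent ℝ fun α => diagonalProlongation r (Y α) p} := by
  rw [dense_iff_inter_open]
  rintro U hU ⟨q, hq⟩
  obtain ⟨ε, hε, hball⟩ := Metric.isOpen_iff.1 hU q hq
  obtain ⟨p, hp, hli⟩ := exists_linearIndependent_prolongation Y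
    (fun i => Metric.ball (q i) ε) (fun i => ⟨q i, Metric.mem_ball_self hε⟩)
    (fun i => hY _ Metric.isOpen_ball ⟨q i, Metric.mem_ball_self hε⟩)
  exact ⟨p, hball ((dist_pi_lt_iff hε).2 hp), hli⟩

theorem exists_point_linearIndependent_prolongation {Y : Fin r → E n → E n}
    (hY : LinearIndependent ℝ Y) :
    ∃ p : Fin r → E n, LinearIndependent ℝ fun α => diagonalProlongation r (Y α) p := by
  obtain ⟨p, -, hp⟩ := exists_linearIndependent_prolongation Y (fun _ => Set.univ)
    (fun _ => Set.univ_nonempty) (fun _ => by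
      rw [Fintype.linearIndependent_iff] at hY ⊢
      intro c hc
      refine hY c (funext fun x => ?_)
      simpa [Finset.sum_apply] using congrFun hc ⟨x, Set.mem_univ x⟩)
  exact ⟨p, hp⟩

theorem le_mul_of_linearIndependent_prolongation {m : ℕ} {Y : Fin r → E n → E n}
    {p : Fin m → E n} (h : LinearIndependent ℝ fun α => diagonalProlongation m (Y α) p) :
    r ≤ m * n := by
  have := h.fintype_card_le_finrank
  simpa [Module.finrank_pi_fintype] using this

end Separation

/-! ### Decompositions from finite-dimensional Lie algebras -/

section Decomposition

variable {n : ℕ}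

/-- A finite-dimensional space of smooth vector fields that is closed under the bracket and
contains all `X_t` gives a decomposition of `X`. -/
theorem exists_decomposition_of_submodule {X : ℝ → E n → E n}
    (hX : ContDiff ℝ ∞ (fun p : ℝ × E n => X p.1 p.2)) (g : Submodule ℝ (E n → E n))
    [FiniteDimensional ℝ g] (hg : ∀ Z ∈ g, ContDiff ℝ ∞ Z)
    (hbr : ∀ Z ∈ g, ∀ W ∈ g, VectorField.lieBracket ℝ Z W ∈ g) (hXg : ∀ t, X t ∈ g) :
    ∃ (r : ℕ) (Y : Fin r → E n → E n) (b : Fin r → ℝ → ℝ),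
      IsLieAlgebraBasis Y ∧ IsDecomposition X Y b ∧ ∀ α, Y α ∈ g := by
  let B := Module.finBasis ℝ g
  let Y : Fin (Module.finrank ℝ g) → E n → E n := fun α => B α
  have hYg : ∀ α, Y α ∈ g := fun α => (B α).2
  have hli : LinearIndependent ℝ Y := B.linearIndependent.map' g.subtype g.ker_subtype
  have hsum : ∀ Z (hZ : Z ∈ g), Z = ∑ α, B.repr ⟨Z, hZ⟩ α • Y α := by
    intro Z hZ
    have := congrArg g.subtype (B.sum_repr ⟨Z, hZ⟩)
    rw [map_sum] at this
    exact this.symm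
  refine ⟨_, Y, fun α t => B.repr ⟨X t, hXg t⟩ α, ⟨fun α => hg _ (hYg α), hli, fun α β => ?_⟩,
    ⟨fun α => ?_, fun t x => ?_⟩, hYg⟩
  · rw [hsum _ (hbr _ (hYg α) _ (hYg β))]
    exact Submodule.sum_mem _ fun γ _ =>
      Submodule.smul_mem _ _ (Submodule.subset_span ⟨γ, rfl⟩)
  -- A linear left inverse recovers the coefficients from the values of `X_t` at finitely many
  -- points, so they are smooth in `t`.
  · obtain ⟨p, hp⟩ := exists_point_linearIndependent_prolongation hli
    obtain ⟨ℓ, hℓ⟩ := LinearMap.exists_leftInverse_of_injective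
      (combinationMap (fun α => diagonalProlongation _ (Y α)) p :
        (Fin (Module.finrank ℝ g) → ℝ) →ₗ[ℝ] Fin (Module.finrank ℝ g) → E n)
      (by rw [LinearMap.ker_eq_bot]; exact combinationMap_injective hp)
    have h1 : ∀ t, B.repr ⟨X t, hXg t⟩ α = ℓ (diagonalProlongation _ (X t) p) α := by
      intro t
      have h2 : diagonalProlongation _ (X t) p =
          combinationMap (fun α => diagonalProlongation _ (Y α)) p
            (fun α => B.repr ⟨X t, hXg t⟩ α) := by
        rw [combinationMap_apply]
        ext1 i
        have := congrFun (hsum _ (hXg t)) (p i)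
        simpa [diagonalProlongation, Finset.sum_apply] using this
      rw [h2]
      exact (congrFun (congrArg (fun T : (Fin (Module.finrank ℝ g) → ℝ) →ₗ[ℝ] _ =>
        T fun α => B.repr ⟨X t, hXg t⟩ α) hℓ) α).symm
    simp only [h1]
    have h3 : ContDiff ℝ ∞ fun t => diagonalProlongation _ (X t) p :=
      contDiff_pi.2 fun i => hX.comp (contDiff_id.prodMk contDiff_const)
    exact contDiff_pi.1 ((LinearMap.toContinuousLinearMap ℓ).contDiff.comp h3) α
  · have := congrFun (hsum _ (hXg t)) x
    simpa [Finset.sum_apply] using this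

/-- The real analytic vector fields. -/
def analyticFields (n : ℕ) : Submodule ℝ (E n → E n) where
  carrier := {Z | AnalyticOnNhd ℝ Z Set.univ}
  add_mem' hZ hW := hZ.add hW
  zero_mem' := analyticOnNhd_const
  smul_mem' _ _ hZ := AnalyticOnNhd.const_smul hZ

/-- A decomposition of an analytic system can be chosen with analytic vector fields. -/
theorem exists_analytic_decomposition {r : ℕ} {X : ℝ → E n → E n}
    (hX : ContDiff ℝ ∞ (fun p : ℝ × E n => X p.1 p.2))
    (hXa : ∀ t, AnalyticOnNhd ℝ (X t) Set.univ) {Y : Fin r → E n → E n} {b : Fin r → ℝ → ℝ}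
    (hY : IsLieAlgebraBasis Y) (hb : IsDecomposition X Y b) :
    ∃ (r : ℕ) (Y : Fin r → E n → E n) (b : Fin r → ℝ → ℝ),
      IsLieAlgebraBasis Y ∧ LinearIndependentOnOpens Y ∧ IsDecomposition X Y b := by
  have hsmooth : ∀ Z ∈ analyticFields n, ContDiff ℝ ∞ Z := fun Z hZ =>
    contDiff_iff_contDiffAt.2 fun x => (hZ x (Set.mem_univ x)).contDiffAt
  have hfd : FiniteDimensional ℝ (Submodule.span ℝ (Set.range Y)) :=
    FiniteDimensional.span_of_finite ℝ (Set.finite_range Y)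
  have hfd' : FiniteDimensional ℝ
      (Submodule.span ℝ (Set.range Y) ⊓ analyticFields n : Submodule ℝ (E n → E n)) :=
    Submodule.finiteDimensional_of_le inf_le_left
  have hdiff : ∀ Z ∈ Submodule.span ℝ (Set.range Y), Differentiable ℝ Z := by
    intro Z hZ
    induction hZ using Submodule.span_induction with
    | mem Z hZ =>
      obtain ⟨α, rfl⟩ := hZ
      exact (hY.contDiff α).differentiable (by simp)
    | zero => exact differentiable_const 0
    | add Z W _ _ hZ hW => exact hZ.add hW
    | smul c Z _ hZ => exact hZ.const_smul c
  have hspan : ∀ Z ∈ Submodule.span ℝ (Set.range Y), ∀ W ∈ Submodule.span ℝ (Set.range Y),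
      VectorField.lieBracket ℝ Z W ∈ Submodule.span ℝ (Set.range Y) := by
    intro Z hZ W hW
    induction hZ, hW using Submodule.span_induction₂ with
    | mem_mem Z W hZ hW =>
      obtain ⟨α, rfl⟩ := hZ
      obtain ⟨β, rfl⟩ := hW
      exact hY.lieBracket_mem α β
    | zero_left W hW =>
      rw [VectorField.lieBracket_zero_left]
      exact Submodule.zero_mem _
    | zero_right W hW =>
      rw [VectorField.lieBracket_zero_right]
      exact Submodule.zero_mem _
    | add_left Z Z' W hZ hZ' hW h h' =>
      have : VectorField.lieBracket ℝ (Z + Z') W =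
          VectorField.lieBracket ℝ Z W + VectorField.lieBracket ℝ Z' W :=
        funext fun x => VectorField.lieBracket_add_left (hdiff Z hZ x) (hdiff Z' hZ' x)
      rw [this]
      exact Submodule.add_mem _ h h'
    | add_right Z W W' hZ hW hW' h h' =>
      have : VectorField.lieBracket ℝ Z (W + W') =
          VectorField.lieBracket ℝ Z W + VectorField.lieBracket ℝ Z W' :=
        funext fun x => VectorField.lieBracket_add_right (hdiff W hW x) (hdiff W' hW' x)
      rw [this]
      exact Submodule.add_mem _ h h'
    | smul_left c Z W hZ hW h =>
      have : VectorField.lieBracket ℝ (c • Z) W = c • VectorField.lieBracket ℝ Z W :=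
        funext fun x => VectorField.lieBracket_const_smul_left (hdiff Z hZ x)
      rw [this]
      exact Submodule.smul_mem _ c h
    | smul_right c Z W hZ hW h =>
      have : VectorField.lieBracket ℝ Z (c • W) = c • VectorField.lieBracket ℝ Z W :=
        funext fun x => VectorField.lieBracket_const_smul_right (hdiff W hW x)
      rw [this]
      exact Submodule.smul_mem _ c h
  -- The analytic fields in the span are still closed under the bracket and contain every `X_t`. The
  -- identity theorem then gives independence on every nonempty open set.
  obtain ⟨r', Y', b', hY', hb', hmem⟩ := exists_decomposition_of_submodule hX
    (Submodule.span ℝ (Set.range Y) ⊓ analyticFields n) (fun Z hZ => hsmooth Z hZ.2)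
    (fun Z hZ W hW => ⟨hspan Z hZ.1 W hW.1,
      contDiff_omega_iff_analyticOnNhd.1 ((contDiff_omega_iff_analyticOnNhd.2 hZ.2
        ).lieBracket_vectorField (contDiff_omega_iff_analyticOnNhd.2 hW.2) le_top)⟩)
    (fun t => ⟨by
      have : X t = ∑ α, b α t • Y α := by
        ext1 x
        simp [hb.2, Finset.sum_apply]
      rw [this]
      exact Submodule.sum_mem _ fun α _ =>
        Submodule.smul_mem _ _ (Submodule.subset_span ⟨α, rfl⟩), hXa t⟩)
  refine ⟨r', Y', b', hY', fun O hO hOne => ?_, hb'⟩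
  rw [Fintype.linearIndependent_iff]
  intro c hc
  have hsum : (∑ α, c α • Y' α) ∈ analyticFields n :=
    Submodule.sum_mem _ fun α _ => Submodule.smul_mem _ _ (hmem α).2
  obtain ⟨x₀, hx₀⟩ := hOne
  have hzero : (∑ α, c α • Y' α) = 0 := by
    refine AnalyticOnNhd.eq_of_eventuallyEq (𝕜 := ℝ) (z₀ := x₀) hsum analyticOnNhd_const ?_
    filter_upwards [hO.mem_nhds hx₀] with x hx
    simpa [Finset.sum_apply] using congrFun hc ⟨x, hx⟩
  exact Fintype.linearIndependent_iff.1 hY'.linearIndependent c hzero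

end Decomposition

/-! ### The Lie algebra defined by a superposition rule -/

section FromSuperpositionRule

variable {n m : ℕ}

theorem exists_solutions {X : ℝ → E n → E n}
    (hX : ContDiff ℝ ∞ (fun p : ℝ × E n => X p.1 p.2)) (t₀ : ℝ) (p : Fin m → E n) :
    ∃ ε > 0, ∃ x : Fin m → ℝ → E n, (∀ i, x i t₀ = p i) ∧
      ∀ i, IsSolutionOn X (Set.Ioo (t₀ - ε) (t₀ + ε)) (x i) := by
  choose ε hε x hx₀ hx using fun i => exists_isSolutionOn hX t₀ (p i)
  -- The filter gives a common radius also for `m = 0`, where no minimum exists.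
  have h1 : ∀ᶠ δ in 𝓝[>] (0 : ℝ), ∀ i, δ < ε i :=
    Filter.eventually_all.2 fun i => nhdsWithin_le_nhds (Iio_mem_nhds (hε i))
  obtain ⟨δ, hδ, hδ₀⟩ := (h1.and self_mem_nhdsWithin).exists
  exact ⟨δ, hδ₀, x, hx₀, fun i => (hx i).mono
    (Set.Ioo_subset_Ioo (by linarith [hδ i]) (by linarith [hδ i]))⟩

namespace IsSuperpositionRule

variable {X : ℝ → E n → E n} {U : Set (Fin m → E n)} {D : Set ((Fin m → E n) × E n)}
  {Φ : (Fin m → E n) × E n → E n}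

/-- Recovering the solution through `y` from solutions through `p`, read off at the initial time,
shows that `Φ(p, ·)` is onto. -/
theorem exists_constant (h : IsSuperpositionRule X U D Φ)
    (hX : ContDiff ℝ ∞ (fun p : ℝ × E n => X p.1 p.2)) {p : Fin m → E n} (hp : p ∈ U) (y : E n) :
    ∃ k, (p, k) ∈ D ∧ Φ (p, k) = y := by
  obtain ⟨ε, hε, x, hx₀, hx⟩ := exists_solutions hX 0 p
  obtain ⟨δ, hδ, z, hz₀, hz⟩ := exists_isSolutionOn hX 0 y
  have hη : 0 < min ε δ := lt_min hε hδ
  have hxp : (fun i => x i 0) = p := funext hx₀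
  obtain ⟨k, hk⟩ := h.recovers (0 - min ε δ) (0 + min ε δ) 0 ⟨by linarith, by linarith⟩ x z
    (fun i => (hx i).mono (Set.Ioo_subset_Ioo (by linarith [min_le_left ε δ])
      (by linarith [min_le_left ε δ])))
    (hz.mono (Set.Ioo_subset_Ioo (by linarith [min_le_right ε δ])
      (by linarith [min_le_right ε δ]))) (by rwa [hxp])
  have hk0 := hk.self_of_nhds
  rw [hxp, hz₀] at hk0
  exact ⟨k, hk0.1, hk0.2.symm⟩

/-- Along solutions through `p` at time `t`, the chain rule and the system give two values for the
derivative of the same curve. -/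
theorem related (h : IsSuperpositionRule X U D Φ)
    (hX : ContDiff ℝ ∞ (fun p : ℝ × E n => X p.1 p.2)) {z : (Fin m → E n) × E n} (hz : z ∈ D)
    (t : ℝ) : fderiv ℝ Φ z (diagonalProlongation m (X t) z.1, 0) = X t (Φ z) := by
  obtain ⟨p, k⟩ := z
  obtain ⟨ε, hε, x, hx₀, hx⟩ := exists_solutions hX t p
  have hxp : (fun i => x i t) = p := funext hx₀
  have ht : t ∈ Set.Ioo (t - ε) (t + ε) := ⟨by linarith, by linarith⟩
  have hder := (hasDerivAt_pi_solution hx ht).prodMk (hasDerivAt_const t k)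
  have hev : ∀ᶠ s in 𝓝 t, ((fun i => x i s), k) ∈ D :=
    hder.continuousAt.preimage_mem_nhds (h.isOpen_domain.mem_nhds (by rwa [hxp]))
  obtain ⟨δ, hδ, hball⟩ := Metric.eventually_nhds_iff_ball.1 hev
  have hη : 0 < min ε δ := lt_min hε hδ
  have hsol := h.isSolution (t - min ε δ) (t + min ε δ) x k
    (fun i => (hx i).mono (Set.Ioo_subset_Ioo (by linarith [min_le_left ε δ])
      (by linarith [min_le_left ε δ])))
    (fun s hs => hball s (by
      rw [Real.ball_eq_Ioo]
      exact Set.Ioo_subset_Ioo (by linarith [min_le_right ε δ])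
        (by linarith [min_le_right ε δ]) hs)) t ⟨by linarith, by linarith⟩
  have hΦ := (h.contDiffOn.contDiffAt (h.isOpen_domain.mem_nhds hz)).differentiableAt (by simp)
    |>.hasFDerivAt
  rw [← hxp] at hΦ
  have hcomp : HasDerivAt (fun s => Φ ((fun i => x i s), k)) _ t :=
    HasFDerivAt.comp_hasDerivAt t hΦ hder
  have := hcomp.unique hsol
  simp only [hxp] at this
  exact this

end IsSuperpositionRule

/-- The smooth vector fields whose prolongations are related to them by all maps `Φ(·, k)`. -/
def relatedFields (D : Set ((Fin m → E n) × E n)) (Φ : (Fin m → E n) × E n → E n) :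
    Submodule ℝ (E n → E n) where
  carrier := {Z | ContDiff ℝ ∞ Z ∧
    ∀ z ∈ D, fderiv ℝ Φ z (diagonalProlongation m Z z.1, 0) = Z (Φ z)}
  add_mem' := by
    rintro Z W ⟨hZ, hZ'⟩ ⟨hW, hW'⟩
    refine ⟨hZ.add hW, fun z hz => ?_⟩
    rw [Pi.add_apply, ← hZ' z hz, ← hW' z hz, ← map_add, Prod.mk_add_mk, add_zero]
    rfl
  zero_mem' := ⟨contDiff_const, fun z _ => map_zero _⟩
  smul_mem' := by
    rintro c Z ⟨hZ, hZ'⟩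
    refine ⟨hZ.const_smul c, fun z hz => ?_⟩
    rw [Pi.smul_apply, ← hZ' z hz, ← map_smul, Prod.smul_mk, smul_zero]
    rfl

/-- For fixed `k`, brackets of `Φ(·, k)`-related fields are related: second derivatives of `Φ(·, k)`
cancel by symmetry, and prolongation commutes with the bracket. -/
theorem lieBracket_mem_relatedFields {D : Set ((Fin m → E n) × E n)}
    {Φ : (Fin m → E n) × E n → E n} (hD : IsOpen D) (hΦ : ContDiffOn ℝ ∞ Φ D) {Z W : E n → E n}
    (hZ : Z ∈ relatedFields D Φ) (hW : W ∈ relatedFields D Φ) :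
    VectorField.lieBracket ℝ Z W ∈ relatedFields D Φ := by
  refine ⟨hZ.1.lieBracket_vectorField hW.1 (by simp), ?_⟩
  have hdiff : ∀ V ∈ relatedFields D Φ, Differentiable ℝ V := fun V hV =>
    hV.1.differentiable (by simp)
  rintro ⟨p, k⟩ hz
  let f : (Fin m → E n) → E n := fun p => Φ (p, k)
  let S : Set (Fin m → E n) := {p | (p, k) ∈ D}
  have hι : ContDiff ℝ ∞ fun p : Fin m → E n => (p, k) := contDiff_id.prodMk contDiff_const
  have hS : IsOpen S := hD.preimage hι.continuous
  have hf : ContDiffOn ℝ ∞ f S := hΦ.comp hι.contDiffOn fun q hq => hq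
  have hfd : ∀ q ∈ S, ∀ d, fderiv ℝ f q d = fderiv ℝ Φ (q, k) (d, 0) := by
    intro q hq d
    have h1 : HasFDerivAt f _ q := HasFDerivAt.comp q (f := fun p : Fin m → E n => (p, k))
      ((hΦ.contDiffAt (hD.mem_nhds hq)).differentiableAt (by simp)).hasFDerivAt
      (hasFDerivAt_prodMk_left q k)
    rw [h1.fderiv]
    rfl
  have hrel : ∀ V ∈ relatedFields D Φ, ∀ q ∈ S,
      fderiv ℝ f q (diagonalProlongation m V q) = V (f q) := fun V hV q hq => by
    rw [hfd q hq]
    exact hV.2 _ hq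
  have hfp : DifferentiableAt ℝ f p :=
    (hf.contDiffAt (hS.mem_nhds hz)).differentiableAt (by simp)
  have hsecond : ∀ V ∈ relatedFields D Φ, ∀ V' ∈ relatedFields D Φ,
      fderiv ℝ (fun q => fderiv ℝ f q (diagonalProlongation m V q)) p
        (diagonalProlongation m V' p) = fderiv ℝ V (f p) (V' (f p)) := by
    intro V hV V' hV'
    have hev : (fun q => fderiv ℝ f q (diagonalProlongation m V q)) =ᶠ[𝓝 p] V ∘ f := by
      filter_upwards [hS.mem_nhds hz] with q hq
      exact hrel V hV q hq
    rw [hev.fderiv_eq, fderiv_comp p (hdiff V hV _) hfp, ContinuousLinearMap.comp_apply,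
      hrel V' hV' p hz]
  rw [← lieBracket_diagonalProlongation (hdiff Z hZ) (hdiff W hW), ← hfd p hz,
    VectorField.fderiv_apply_lieBracket (hf.contDiffAt (hS.mem_nhds hz))
      (by rw [minSmoothness_of_isRCLikeNormedField]; exact WithTop.coe_le_coe.2 le_top)
      ((contDiff_diagonalProlongation hW.1).differentiable (by simp) p)
      ((contDiff_diagonalProlongation hZ.1).differentiable (by simp) p),
    hsecond W hW Z hZ, hsecond Z hZ W hW]
  rfl

/-- A superposition rule yields a decomposition whose prolongations are linearly independent at
every `m`-tuple in `U`. -/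
theorem IsSuperpositionRule.exists_decomposition {X : ℝ → E n → E n}
    (hX : ContDiff ℝ ∞ (fun p : ℝ × E n => X p.1 p.2)) {U : Set (Fin m → E n)}
    {D : Set ((Fin m → E n) × E n)} {Φ : (Fin m → E n) × E n → E n}
    (h : IsSuperpositionRule X U D Φ) (hU : U.Nonempty) :
    ∃ (r : ℕ) (Y : Fin r → E n → E n) (b : Fin r → ℝ → ℝ),
      IsLieAlgebraBasis Y ∧ IsDecomposition X Y b ∧
      ∀ p ∈ U, LinearIndependent ℝ fun α => diagonalProlongation m (Y α) p := by
  -- Each `y` is `Φ(p, k)` for some `k`, so `Z(y)` is a linear image of the prolongation of `Z` at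
  -- `p`.
  have hzero : ∀ Z ∈ relatedFields D Φ, ∀ p ∈ U, diagonalProlongation m Z p = 0 → Z = 0 := by
    intro Z hZ p hp h0
    ext1 y
    obtain ⟨k, hk, rfl⟩ := h.exists_constant hX hp y
    rw [← hZ.2 _ hk, h0]
    exact map_zero _
  obtain ⟨p₀, hp₀⟩ := hU
  let ev : relatedFields D Φ →ₗ[ℝ] (Fin m → E n) :=
    { toFun := fun Z => diagonalProlongation m Z p₀
      map_add' := fun _ _ => rfl
      map_smul' := fun _ _ => rfl }
  have hinj : Function.Injective ev := (injective_iff_map_eq_zero ev).2 fun Z hZ =>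
    Subtype.ext (hzero Z Z.2 p₀ hp₀ hZ)
  have : FiniteDimensional ℝ (relatedFields D Φ) := FiniteDimensional.of_injective ev hinj
  obtain ⟨r, Y, b, hY, hb, hmem⟩ := exists_decomposition_of_submodule hX (relatedFields D Φ)
    (fun Z hZ => hZ.1)
    (fun Z hZ W hW => lieBracket_mem_relatedFields h.isOpen_domain h.contDiffOn hZ hW)
    (fun t => ⟨hX.comp (contDiff_const.prodMk contDiff_id), fun z hz => h.related hX hz t⟩)
  refine ⟨r, Y, b, hY, hb, fun p hp => ?_⟩
  rw [Fintype.linearIndependent_iff]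
  intro c hc
  refine Fintype.linearIndependent_iff.1 hY.linearIndependent c (hzero _
    (Submodule.sum_mem _ fun α _ => Submodule.smul_mem _ _ (hmem α)) p hp ?_)
  rw [← hc]
  ext1 i
  simp [diagonalProlongation, Finset.sum_apply]

end FromSuperpositionRule

/-! ### The equivalences of the theorem -/

section Equivalences

variable {n : ℕ} {X : ℝ → E n → E n}

theorem IsLieAlgebraBasis.dense_of_generic {r m : ℕ} {Y : Fin r → E n → E n}
    (hY : IsLieAlgebraBasis Y)
    (hgen : LinearIndependentAtGenericPoint fun α => diagonalProlongation m (Y α)) :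
    Dense {p | LinearIndependent ℝ fun α => diagonalProlongation m (Y α) p} :=
  hgen.dense fun α => contDiff_diagonalProlongation (hY.contDiff α)

theorem IsLieAlgebraBasis.isOpen_setOf_linearIndependent {r m : ℕ} {Y : Fin r → E n → E n}
    (hY : IsLieAlgebraBasis Y) :
    IsOpen {p | LinearIndependent ℝ fun α => diagonalProlongation m (Y α) p} :=
  isOpen_setOf_linearIndependent_fields
    (fun α => (contDiff_diagonalProlongation (hY.contDiff α)).continuous) id

theorem exists_regular_rule_of_generic (hX : ContDiff ℝ ∞ (fun p : ℝ × E n => X p.1 p.2))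
    {r m : ℕ} {Y : Fin r → E n → E n} {b : Fin r → ℝ → ℝ} (hY : IsLieAlgebraBasis Y)
    (hb : IsDecomposition X Y b)
    (hgen : LinearIndependentAtGenericPoint fun α => diagonalProlongation m (Y α)) :
    ∃ (U : Set (Fin m → E n)) (D : Set ((Fin m → E n) × E n)) (Φ : (Fin m → E n) × E n → E n),
      IsOpen U ∧ Dense U ∧ IsSuperpositionRule X U D Φ ∧
      ∀ z ∈ D, Function.Bijective (fderiv ℝ (fun k : E n => Φ (z.1, k)) z.2) := by
  obtain ⟨D, Φ, hrule, hbij⟩ := exists_isSuperpositionRule hX hY hb _ fun p hp => hp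
  exact ⟨_, D, Φ, hY.isOpen_setOf_linearIndependent, hY.dense_of_generic hgen, hrule, hbij⟩

theorem AdmitsSuperpositionRule.exists_generic_decomposition
    (hX : ContDiff ℝ ∞ (fun p : ℝ × E n => X p.1 p.2)) {m : ℕ}
    (h : AdmitsSuperpositionRule X m) :
    ∃ (r : ℕ) (Y : Fin r → E n → E n) (b : Fin r → ℝ → ℝ),
      IsLieAlgebraBasis Y ∧ IsDecomposition X Y b ∧
      LinearIndependentAtGenericPoint (fun α => diagonalProlongation m (Y α)) ∧ r ≤ m * n ∧
      LinearIndependentOnOpens Y := by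
  obtain ⟨U, D, Φ, -, hUd, hrule⟩ := h
  obtain ⟨r, Y, b, hY, hb, hli⟩ := hrule.exists_decomposition hX hUd.nonempty
  refine ⟨r, Y, b, hY, hb,
    linearIndependentAtGenericPoint_of_dense (hUd.mono fun p hp => hli p hp), ?_, ?_⟩
  · obtain ⟨p, hp⟩ := hUd.nonempty
    exact le_mul_of_linearIndependent_prolongation (hli p hp)
  · rintro O hO ⟨x, hx⟩
    -- The dense set `U` meets `Oᵐ`; a constant-coefficient relation on `O` holds at all components
    -- of a common point, hence is trivial.
    obtain ⟨p, hpO, hpU⟩ := hUd.inter_open_nonempty (Set.univ.pi fun _ => O)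
      (isOpen_set_pi Set.finite_univ fun _ _ => hO) ⟨fun _ => x, fun _ _ => hx⟩
    rw [Fintype.linearIndependent_iff]
    intro c hc
    refine Fintype.linearIndependent_iff.1 (hli p hpU) c ?_
    ext1 i
    simpa [diagonalProlongation, Finset.sum_apply] using
      congrFun hc ⟨p i, hpO i (Set.mem_univ i)⟩

/-- The number `r` itself qualifies, by separation of relations, so a least number exists; comparing
dimensions at one independent point bounds `r`. -/
theorem exists_minimal_number (hX : ContDiff ℝ ∞ (fun p : ℝ × E n => X p.1 p.2))
    {r : ℕ} {Y : Fin r → E n → E n} {b : Fin r → ℝ → ℝ} (hY : IsLieAlgebraBasis Y)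
    (hO : LinearIndependentOnOpens Y) (hb : IsDecomposition X Y b) :
    ∃ m : ℕ,
      IsLeast {q : ℕ |
        LinearIndependentAtGenericPoint (fun α => diagonalProlongation q (Y α))} m ∧
      m ≤ r ∧ r ≤ m * n ∧ AdmitsSuperpositionRule X m := by
  classical
  have hr : LinearIndependentAtGenericPoint (fun α => diagonalProlongation r (Y α)) :=
    linearIndependentAtGenericPoint_of_dense (dense_linearIndependent_prolongation hO)
  have hex : ∃ q, LinearIndependentAtGenericPoint (fun α => diagonalProlongation q (Y α)) :=
    ⟨r, hr⟩
  have hm := Nat.find_spec hex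
  refine ⟨Nat.find hex, ⟨hm, fun q hq => Nat.find_min' hex hq⟩, Nat.find_min' hex hr, ?_, ?_⟩
  · obtain ⟨p, hp⟩ := (hY.dense_of_generic hm).nonempty
    exact le_mul_of_linearIndependent_prolongation hp
  · obtain ⟨U, D, Φ, hU, hUd, hrule, -⟩ := exists_regular_rule_of_generic hX hY hb hm
    exact ⟨U, D, Φ, hU, hUd, hrule⟩

end Equivalences

theorem mainTheorem1 (n : ℕ) (X : ℝ → E n → E n)
    (hX : ContDiff ℝ ∞ (fun p : ℝ × E n => X p.1 p.2)) :
    -- the theorem for smooth systems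
    ((∃ m : ℕ, AdmitsSuperpositionRule X m) ↔
      ∃ (r : ℕ) (Y : Fin r → E n → E n) (b : Fin r → ℝ → ℝ),
        IsLieAlgebraBasis Y ∧ LinearIndependentOnOpens Y ∧ IsDecomposition X Y b) ∧
    -- the theorem with a prescribed number `m` of particular solutions, and the bound on `r`
    (∀ m : ℕ, AdmitsSuperpositionRule X m ↔
      ∃ (r : ℕ) (Y : Fin r → E n → E n) (b : Fin r → ℝ → ℝ),
        IsLieAlgebraBasis Y ∧ IsDecomposition X Y b ∧
        LinearIndependentAtGenericPoint (fun α => diagonalProlongation m (Y α)) ∧ r ≤ m * n) ∧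
    -- the minimal number `m` attached to a decomposition
    (∀ (r : ℕ) (Y : Fin r → E n → E n) (b : Fin r → ℝ → ℝ),
      IsLieAlgebraBasis Y → LinearIndependentOnOpens Y → IsDecomposition X Y b →
      ∃ m : ℕ,
        IsLeast {q : ℕ |
          LinearIndependentAtGenericPoint (fun α => diagonalProlongation q (Y α))} m ∧
        m ≤ r ∧ r ≤ m * n ∧ AdmitsSuperpositionRule X m) ∧
    -- the map `Φ(x₍₁₎, …, x₍ₘ₎; ·)` can be taken locally invertible
    (∀ m : ℕ, AdmitsSuperpositionRule X m →
      ∃ (U : Set (Fin m → E n)) (D : Set ((Fin m → E n) × E n))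
        (Φ : (Fin m → E n) × E n → E n),
        IsOpen U ∧ Dense U ∧ IsSuperpositionRule X U D Φ ∧
        ∀ z ∈ D, Function.Bijective (fderiv ℝ (fun k : E n => Φ (z.1, k)) z.2)) ∧
    -- systems depending analytically on `x`
    ((∀ t, AnalyticOnNhd ℝ (X t) Set.univ) →
      ((∃ m : ℕ, AdmitsSuperpositionRule X m) ↔
        ∃ (r : ℕ) (Y : Fin r → E n → E n) (b : Fin r → ℝ → ℝ),
          IsLieAlgebraBasis Y ∧ IsDecomposition X Y b)) ∧
    -- smooth systems, `m`-tuples from some nonempty open set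
    ((∃ (m : ℕ) (U : Set (Fin m → E n)) (D : Set ((Fin m → E n) × E n))
        (Φ : (Fin m → E n) × E n → E n),
        IsOpen U ∧ U.Nonempty ∧ IsSuperpositionRule X U D Φ) ↔
      ∃ (r : ℕ) (Y : Fin r → E n → E n) (b : Fin r → ℝ → ℝ),
        IsLieAlgebraBasis Y ∧ IsDecomposition X Y b) := by
  have hpart1 : (∃ m : ℕ, AdmitsSuperpositionRule X m) ↔
      ∃ (r : ℕ) (Y : Fin r → E n → E n) (b : Fin r → ℝ → ℝ),
        IsLieAlgebraBasis Y ∧ LinearIndependentOnOpens Y ∧ IsDecomposition X Y b := by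
    constructor
    · rintro ⟨m, hm⟩
      obtain ⟨r, Y, b, hY, hb, -, -, hO⟩ := hm.exists_generic_decomposition hX
      exact ⟨r, Y, b, hY, hO, hb⟩
    · rintro ⟨r, Y, b, hY, hO, hb⟩
      obtain ⟨m, -, -, -, hm⟩ := exists_minimal_number hX hY hO hb
      exact ⟨m, hm⟩
  refine ⟨hpart1, fun m => ⟨fun hm => ?_, ?_⟩, fun r Y b hY hO hb =>
    exists_minimal_number hX hY hO hb, fun m hm => ?_, fun hXa => hpart1.trans ⟨?_, ?_⟩, ?_, ?_⟩
  · obtain ⟨r, Y, b, hY, hb, hgen, hr, -⟩ := hm.exists_generic_decomposition hX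
    exact ⟨r, Y, b, hY, hb, hgen, hr⟩
  · rintro ⟨r, Y, b, hY, hb, hgen, -⟩
    obtain ⟨U, D, Φ, hU, hUd, hrule, -⟩ := exists_regular_rule_of_generic hX hY hb hgen
    exact ⟨U, D, Φ, hU, hUd, hrule⟩
  · obtain ⟨r, Y, b, hY, hb, hgen, -, -⟩ := hm.exists_generic_decomposition hX
    exact exists_regular_rule_of_generic hX hY hb hgen
  · rintro ⟨r, Y, b, hY, -, hb⟩
    exact ⟨r, Y, b, hY, hb⟩
  · rintro ⟨r, Y, b, hY, hb⟩
    exact exists_analytic_decomposition hX hXa hY hb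
  · rintro ⟨m, U, D, Φ, -, hU, hrule⟩
    obtain ⟨r, Y, b, hY, hb, -⟩ := hrule.exists_decomposition hX hU
    exact ⟨r, Y, b, hY, hb⟩
  -- Global independence over `ℝ` still gives one independent `r`-tuple, and independence is an open
  -- condition; only density of `U` may be lost.
  · rintro ⟨r, Y, b, hY, hb⟩
    obtain ⟨D, Φ, hrule, -⟩ := exists_isSuperpositionRule hX hY hb
      {p : Fin r → E n | LinearIndependent ℝ fun α => diagonalProlongation r (Y α) p}
      fun p hp => hp
    exact ⟨r, _, D, Φ, hY.isOpen_setOf_linearIndependent,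
      exists_point_linearIndependent_prolongation hY.linearIndependent, hrule⟩
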